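/- **Theorem (Consistency of the MSLE).** *Model.* Let $(X_i,T_i,U_i)$, $i\ge 1$, be i.i.d. random triples such that $X_i$ has distribution function $F_0$ and is independent of $(T_i,U_i)$, which has density $g\ge 0$ on $\mathbb R^2$ with marginals $g_1(t)=\int g(t,u)\,du$ and $g_2(u)=\int g(t,u)\,dt$. Put $\Delta_{i1}=1_{\{X_i\le T_i\}}$, $\Delta_{i2}=1_{\{T_i<X_i\le U_i\}}$, $\Delta_{i3}=1-\Delta_{i1}-\Delta_{i2}$. Assume that for some $M$ and some $0<\varepsilon\le M/2$: - (S1) $g_1,g_2$ are continuous on $[0,M]$ and $g_1(x)+g_2(x)>0$ for all $x\in[0,M]$; - (S2) $P\{U_i-T_i<\varepsilon\}=0$; - (S3) $g$ is continuous on $\{0\le t<u<M\}$, vanishes outside $\{0\le t<u\le M\}$, and $g(t,u)=0$ if $u-t<\varepsilon$; - (S4) $F_0$ is continuous, $X_i\in[0,M]$ almost surely, and there is $c>0$ such that $F_0(u)-F_0(t)\ge c$ for all $t,u\in[0,M]$ with $u-t\ge\varepsilon$; - (S5) at each point of $\{0<t<u<M\}$ the one-sided partial derivatives of $g$ in each variable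 exist, they are bounded uniformly over this set, and on each line parallel to an axis the left and right derivatives along the line coincide except at countably many points; - (S6) the law of $X_i$ is absolutely continuous with respect to $G_1+G_2$, where $G_j$ is the measure with density $g_j$. *Kernel estimators.* Let $K$ be a symmetric continuously differentiable probability density with support in $[-1,1]$, and let $\alpha,\beta$ satisfy, for $u\in[0,1]$, $$\alpha(u)\int_{-1}^uK(x)\,dx+\beta(u)\int_{-1}^uxK(x)\,dx=1,\qquad \alpha(u)\int_{-1}^uxK(x)\,dx+\beta(u)\int_{-1}^ux^2K(x)\,dx=0,$$ where $\alpha,\beta$ are differentiable on $[0,1]$ and $\alpha,\beta,\alpha',\beta'$ are bounded there. Let $b_n>0$ with $b_n\to0$, and let $K_b(x)=b^{-1}K(x/b)$. For $t\in[0,M]$ define the weight $w_b(t,x)$ as $$\alpha(t/b)K_b(t-x)+\beta(t/b)\tfrac{t-x}bK_b(t-x)\quad\text{if } t<b,$$ $$\alpha((M-t)/b)K_b(t-x)-\beta((M-t)/b)\tfrac{t-x}bK_b(t-x)\quad\text{if } t\ge b,\ t>M-b,$$ and $K_b(t-x)$ otherwise. Let $$h_{n1}(t)=\Bigl(\tfrac1n\sum_{i\le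 n}w_{b_n}(t,T_i)\Delta_{i1}\Bigr)\vee0,\qquad h_{n2}(u)=\Bigl(\tfrac1n\sum_{i\le n}w_{b_n}(u,U_i)\Delta_{i3}\Bigr)\vee0,$$ $$h_n(t,u)=\Bigl(\tfrac1n\sum_{i\le n}w_{b_n}(t,T_i)\,w_{b_n}(u,U_i)\Delta_{i2}\Bigr)\vee0,$$ and let $\tilde h_{n1},\tilde h_{n2},\tilde h_n$ be these functions divided by $\int_{[0,M]}(h_{n1}+h_{n2})+\int_{[0,M]^2}h_n$ (a quotient by $0$ being read as $0$). *The estimator.* For every $n\ge1$ let, almost surely, $\hat F_n$ be an MSLE, that is, a maximizer of $$\ell(F)=\int_0^M\tilde h_{n1}(t)\log F(t)\,dt+\int_0^M\tilde h_{n2}(u)\log\{1-F(u)\}\,du+\int_{[0,M]^2}\tilde h_n(t,u)\log\{F(u)-F(t)\}\,dt\,du$$ over all (sub-)distribution functions $F$ on $[0,M]$ (nondecreasing, right continuous, with values in $[0,1]$), where $\log y=-\infty$ for $y\le0$ and $0\cdot(-\infty)=0$. *Conclusion.* With probability one, $$\lim_{n\to\infty}\hat F_n(t)=F_0(t)\quad\text{for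 each } t\in[0,M),$$ and the convergence is uniform on each interval $[a,b]$ with $0<a\le b<M$. -/

import Mathlib

open MeasureTheory ProbabilityTheory Filter Set
open scoped Topology ENNReal

noncomputable section

namespace IntervalCensoring

/-! The model -/

/-- First marginal `g₁` of a density `g` on the plane. -/
def marginal₁ (g : ℝ → ℝ → ℝ) (t : ℝ) : ℝ := ∫ u, g t u

/-- Second marginal `g₂` of a density `g` on the plane. -/
def marginal₂ (g : ℝ → ℝ → ℝ) (u : ℝ) : ℝ := ∫ t, g t u

/-- The measure on the plane with Lebesgue density `g`. -/
def obsLaw (g : ℝ → ℝ → ℝ) : Measure (ℝ × ℝ) :=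
  volume.withDensity fun p => ENNReal.ofReal (g p.1 p.2)

/-- The sampling scheme of interval censoring, case 2: i.i.d. triples `(Xᵢ, Tᵢ, Uᵢ)`, where the
hidden `Xᵢ` has law `ν` and is independent of the pair `(Tᵢ, Uᵢ)`, which has density `g`. -/
structure IsSample {Ω : Type*} [MeasurableSpace Ω] (P : Measure Ω)
    (X T U : ℕ → Ω → ℝ) (ν : Measure ℝ) (g : ℝ → ℝ → ℝ) : Prop where
  measurable_X : ∀ i, Measurable (X i)
  measurable_T : ∀ i, Measurable (T i)
  measurable_U : ∀ i, Measurable (U i)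
  indep_triples : iIndepFun (fun i ω => (X i ω, T i ω, U i ω)) P
  indep_hidden : ∀ i, IndepFun (X i) (fun ω => (T i ω, U i ω)) P
  law_X : ∀ i, P.map (X i) = ν
  law_TU : ∀ i, P.map (fun ω => (T i ω, U i ω)) = obsLaw g

/-- The conditions (S1)-(S6) (separated case) on the law `ν` of the hidden variable, with
distribution function `cdf ν`, and on the observation density `g`, on `[0, M]` with separation
constant `ε`. -/
structure SeparatedCase (M ε : ℝ) (ν : Measure ℝ) (g : ℝ → ℝ → ℝ) : Prop where
  g_measurable : Measurable fun p : ℝ × ℝ => g p.1 p.2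
  g_nonneg : ∀ t u, 0 ≤ g t u
  /-- (S1) -/
  marginal₁_cont : ContinuousOn (marginal₁ g) (Icc 0 M)
  marginal₂_cont : ContinuousOn (marginal₂ g) (Icc 0 M)
  marginal_pos : ∀ x ∈ Icc 0 M, 0 < marginal₁ g x + marginal₂ g x
  /-- (S2) -/
  eps_pos : 0 < ε
  eps_le : ε ≤ M / 2
  separated : obsLaw g {p | p.2 - p.1 < ε} = 0
  /-- (S3) -/
  g_cont : ContinuousOn (fun p : ℝ × ℝ => g p.1 p.2) {p | 0 ≤ p.1 ∧ p.1 < p.2 ∧ p.2 < M}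
  g_zero_outside : ∀ t u, ¬ (0 ≤ t ∧ t < u ∧ u ≤ M) → g t u = 0
  g_zero_near_diag : ∀ t u, u - t < ε → g t u = 0
  /-- (S4) -/
  F_cont : Continuous (cdf ν)
  F_supp : ν (Icc 0 M)ᶜ = 0
  F_incr : ∃ c > 0, ∀ t ∈ Icc 0 M, ∀ u ∈ Icc 0 M, ε ≤ u - t → c ≤ cdf ν u - cdf ν t
  /-- (S5): on every horizontal and every vertical line the partial derivative exists off a
  countable set, one-sided derivatives exist throughout, and all of them are bounded. -/
  partial₁_countable : ∀ u, {t | 0 < t ∧ t < u ∧ u < M ∧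
    ¬ DifferentiableAt ℝ (fun s => g s u) t}.Countable
  partial₂_countable : ∀ t, {u | 0 < t ∧ t < u ∧ u < M ∧
    ¬ DifferentiableAt ℝ (fun s => g t s) u}.Countable
  partial_bounded : ∃ C : ℝ, ∀ t u, 0 < t → t < u → u < M →
    (∃ l r, HasDerivWithinAt (fun s => g s u) l (Iio t) t ∧
      HasDerivWithinAt (fun s => g s u) r (Ioi t) t ∧ |l| ≤ C ∧ |r| ≤ C) ∧
    (∃ l r, HasDerivWithinAt (fun s => g t s) l (Iio u) u ∧
      HasDerivWithinAt (fun s => g t s) r (Ioi u) u ∧ |l| ≤ C ∧ |r| ≤ C)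
  /-- (S6) -/
  F_abs_cont : ν ≪ volume.withDensity (fun x => ENNReal.ofReal (marginal₁ g x)) +
    volume.withDensity (fun x => ENNReal.ofReal (marginal₂ g x))

/-! The kernel estimators -/

/-- A symmetric continuously differentiable probability density supported in `[-1, 1]`. -/
structure IsKernel (K : ℝ → ℝ) : Prop where
  contDiff : ContDiff ℝ 1 K
  symm : ∀ x, K (-x) = K x
  nonneg : ∀ x, 0 ≤ K x
  support_subset : Function.support K ⊆ Icc (-1) 1
  integral_eq_one : ∫ x, K x = 1

/-- `α` and `β` are the coefficients of the boundary kernels of `K`; they and their derivatives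
are bounded on `[0, 1]`. -/
structure IsBoundaryCoeff (K α β : ℝ → ℝ) : Prop where
  mass : ∀ u ∈ Icc (0 : ℝ) 1,
    α u * (∫ x in (-1)..u, K x) + β u * (∫ x in (-1)..u, x * K x) = 1
  moment : ∀ u ∈ Icc (0 : ℝ) 1,
    α u * (∫ x in (-1)..u, x * K x) + β u * (∫ x in (-1)..u, x ^ 2 * K x) = 0
  diff_α : DifferentiableOn ℝ α (Icc 0 1)
  diff_β : DifferentiableOn ℝ β (Icc 0 1)
  bounded : ∃ C : ℝ, ∀ u ∈ Icc (0 : ℝ) 1, |α u| ≤ C ∧ |β u| ≤ C ∧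
    |derivWithin α (Icc 0 1) u| ≤ C ∧ |derivWithin β (Icc 0 1) u| ≤ C

/-- The weight that the observation point `x` gets in a kernel estimate at `t ∈ [0, M]` with
bandwidth `b`: `K_b (t - x) = K ((t - x) / b) / b` in the interior, and the boundary kernel if `t`
has distance less than `b` to an end point of `[0, M]`. -/
def weight (K α β : ℝ → ℝ) (M b t x : ℝ) : ℝ :=
  if t < b then
    α (t / b) * (K ((t - x) / b) / b) + β (t / b) * ((t - x) / b * (K ((t - x) / b) / b))
  else if M - b < t then
    α ((M - t) / b) * (K ((t - x) / b) / b)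
      - β ((M - t) / b) * ((t - x) / b * (K ((t - x) / b) / b))
  else K ((t - x) / b) / b

/-- `Δ₁ = 1{X ≤ T}` -/
def Δ₁ (x t : ℝ) : ℝ := if x ≤ t then 1 else 0

/-- `Δ₂ = 1{T < X ≤ U}` -/
def Δ₂ (x t u : ℝ) : ℝ := if t < x ∧ x ≤ u then 1 else 0

/-- `Δ₃ = 1 - Δ₁ - Δ₂` -/
def Δ₃ (x t u : ℝ) : ℝ := 1 - Δ₁ x t - Δ₂ x t u

/-- The estimate of `h₀₁ = F₀ g₁` (before normalization) with weights `w`, computed from the first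
`n` terms of the data `x, t`; negative values are replaced by `0`. -/
def raw₁ (w : ℝ → ℝ → ℝ) (n : ℕ) (x t : ℕ → ℝ) (s : ℝ) : ℝ :=
  max 0 ((1 / (n : ℝ)) * ∑ i ∈ Finset.range n, w s (t i) * Δ₁ (x i) (t i))

/-- The estimate of `h₀₂ = (1 - F₀) g₂` (before normalization). -/
def raw₂ (w : ℝ → ℝ → ℝ) (n : ℕ) (x t u : ℕ → ℝ) (s : ℝ) : ℝ :=
  max 0 ((1 / (n : ℝ)) * ∑ i ∈ Finset.range n, w s (u i) * Δ₃ (x i) (t i) (u i))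

/-- The estimate of `h₀(t, u) = (F₀(u) - F₀(t)) g(t, u)` (before normalization). -/
def raw (w : ℝ → ℝ → ℝ) (n : ℕ) (x t u : ℕ → ℝ) (r s : ℝ) : ℝ :=
  max 0 ((1 / (n : ℝ)) *
    ∑ i ∈ Finset.range n, w r (t i) * w s (u i) * Δ₂ (x i) (t i) (u i))

/-- The total mass of the three estimates on `[0, M]`, `[0, M]` and `[0, M]²`. -/
def totalMass (w : ℝ → ℝ → ℝ) (M : ℝ) (n : ℕ) (x t u : ℕ → ℝ) : ℝ :=
  (∫ s in Icc 0 M, (raw₁ w n x t s + raw₂ w n x t u s)) +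
    ∫ p in Icc (0 : ℝ) M ×ˢ Icc (0 : ℝ) M, raw w n x t u p.1 p.2

/-- The normalized estimate of `h₀₁`. -/
def hTilde₁ (w : ℝ → ℝ → ℝ) (M : ℝ) (n : ℕ) (x t u : ℕ → ℝ) (s : ℝ) : ℝ :=
  raw₁ w n x t s / totalMass w M n x t u

/-- The normalized estimate of `h₀₂`. -/
def hTilde₂ (w : ℝ → ℝ → ℝ) (M : ℝ) (n : ℕ) (x t u : ℕ → ℝ) (s : ℝ) : ℝ :=
  raw₂ w n x t u s / totalMass w M n x t u

/-- The normalized estimate of `h₀`. -/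
def hTilde (w : ℝ → ℝ → ℝ) (M : ℝ) (n : ℕ) (x t u : ℕ → ℝ) (r s : ℝ) : ℝ :=
  raw w n x t u r s / totalMass w M n x t u

/-! The maximum smoothed likelihood estimator -/

/-- `-log y ∈ [0, ∞]` for `y ≤ 1`, with value `∞` for `y ≤ 0`. -/
def negLog (y : ℝ) : ℝ≥0∞ := if 0 < y then ENNReal.ofReal (-Real.log y) else ⊤

/-- Restrictions to `[0, M]` of distribution functions on `[0, ∞)`, that is, (sub-)distribution
functions on `[0, M]`: nondecreasing and right continuous with values in `[0, 1]`. -/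
structure IsDistFun (M : ℝ) (F : ℝ → ℝ) : Prop where
  mono : MonotoneOn F (Icc 0 M)
  right_cont : ∀ t ∈ Ico 0 M, ContinuousWithinAt F (Icc t M) t
  mem_unit : ∀ t ∈ Icc 0 M, F t ∈ Icc (0 : ℝ) 1

/-- The smoothed log likelihood
`ℓ(F) = ∫ h₁ log F + ∫ h₂ log (1 - F) + ∫∫ h(t, u) log (F(u) - F(t)) dt du`
over `[0, M]`, `[0, M]` and `[0, M]²`, as an element of `[-∞, 0]`; here `log y = -∞` for `y ≤ 0`
and `0 · (-∞) = 0`. -/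
def logLik (M : ℝ) (h₁ h₂ : ℝ → ℝ) (h : ℝ → ℝ → ℝ) (F : ℝ → ℝ) : EReal :=
  -(((∫⁻ t in Icc 0 M, ENNReal.ofReal (h₁ t) * negLog (F t)) +
    (∫⁻ u in Icc 0 M, ENNReal.ofReal (h₂ u) * negLog (1 - F u)) +
    ∫⁻ p in Icc (0 : ℝ) M ×ˢ Icc (0 : ℝ) M,
      ENNReal.ofReal (h p.1 p.2) * negLog (F p.2 - F p.1) : ℝ≥0∞) : EReal)

/-- `F` maximizes the smoothed log likelihood over all (sub-)distribution functions. -/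
def IsMaximizer (M : ℝ) (h₁ h₂ : ℝ → ℝ) (h : ℝ → ℝ → ℝ) (F : ℝ → ℝ) : Prop :=
  IsDistFun M F ∧ ∀ G, IsDistFun M G → logLik M h₁ h₂ h G ≤ logLik M h₁ h₂ h F

/-- `F` is a maximum smoothed likelihood estimate for the first `n` terms of the data `x, t, u`,
with kernel `K`, boundary coefficients `α, β` and bandwidth `b`. -/
def IsMSLE (K α β : ℝ → ℝ) (M b : ℝ) (n : ℕ) (x t u : ℕ → ℝ) (F : ℝ → ℝ) : Prop :=
  IsMaximizer M (hTilde₁ (weight K α β M b) M n x t u) (hTilde₂ (weight K α β M b) M n x t u)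
    (hTilde (weight K α β M b) M n x t u) F

end IntervalCensoring

end

namespace IntervalCensoring

/-! The kernel estimates are never shown to converge. The maximizing property is turned into an
inequality between sample averages that involves no logarithm, and this inequality is passed to the
limit.

A maximizer `F` is compared with its midpoint with `G`, the true distribution function. From `log x
≤ x - 1`, applied to the ratio of `F` to the midpoint, the integral of `ratio G F` against the
smoothed data, summed over the three types of observation, is at most their total mass
(`IsMaximizer.lintegral_ratio_le`). The midpoint serves because `ratio` is bounded by 2, however
small `F` may be.

Since `ratio` increases in its first argument and decreases in its second, and `F` and `G` are
monotone, on a kernel window it is bounded below by a value depending only on the grid cell of the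
observation. A kernel centred at an observation away from the end points has mass one, so the
smoothing integrates out. What remains is an inequality between plain averages over the sample, with
an error factor from the boundary weights (`IsMSLE.average_lowerRatio_le`). The bandwidth must only
be smaller than the mesh and than half the separation.

With the mesh fixed there are finitely many cells, so the strong law for their indicators and the
convergence of `F` along an ultrafilter to a monotone `L` give the inequality in the limit. Letting
the mesh tend to zero removes both the discretization and the boundary error: the integral of `∑ pᵢ
* ratio pᵢ qᵢ` is at most 1, where `p` and `q` are the probabilities of the three types under `G`
and `L`. By `mul_ratio_ge` this integral is at least 1 plus a multiple of the mean squared distance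
between `L` and `G`. Hence `L = G` at almost all observation points, and on `[0, M)` by positivity
of the marginals, monotonicity and continuity (`SeparatedCase.eq_cdf_of_ae`). All ultrafilter limits
agree, so the estimates converge; monotonicity makes the convergence uniform on compact
subintervals. -/

/-! ### The ratio to the midpoint and its inequalities -/

/-- Twice the weight of `p` in the mixture of `p` and `q`. -/
noncomputable def ratio (p q : ℝ) : ℝ := 2 * p / (p + q)

lemma ratio_nonneg {p q : ℝ} (hp : 0 ≤ p) (hq : 0 ≤ q) : 0 ≤ ratio p q := by
  unfold ratio; positivity

lemma ratio_zero_left (q : ℝ) : ratio 0 q = 0 := by simp [ratio]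

lemma ratio_le_two {p q : ℝ} (hp : 0 ≤ p) (hq : 0 ≤ q) : ratio p q ≤ 2 := by
  unfold ratio
  exact div_le_of_le_mul₀ (by positivity) (by norm_num) (by linarith)

/-- This monotonicity allows values at observations to be replaced by values at grid points. For `p
> 0` cross multiplication reduces it to `p * q' ≤ p' * q`; the case `p = 0` is separate because a
denominator may vanish there. -/
lemma ratio_mono {p p' q q' : ℝ} (hp : 0 ≤ p) (hpp : p ≤ p') (hq : 0 ≤ q') (hqq : q' ≤ q) :
    ratio p q ≤ ratio p' q' := by
  rcases hp.eq_or_lt with rfl | hp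
  · rw [ratio_zero_left]; exact ratio_nonneg hpp hq
  · unfold ratio
    rw [div_le_div_iff₀ (by linarith) (by linarith)]
    nlinarith [mul_le_mul hpp hqq hq (by linarith)]

lemma tendsto_ratio {ι : Type*} {l : Filter ι} {p q : ι → ℝ} {p₀ q₀ : ℝ}
    (hp : Tendsto p l (𝓝 p₀)) (hq : Tendsto q l (𝓝 q₀)) (hp₀ : 0 < p₀) (hq₀ : 0 ≤ q₀) :
    Tendsto (fun i => ratio (p i) (q i)) l (𝓝 (ratio p₀ q₀)) :=
  (hp.const_mul 2).div (hp.add hq) (by positivity)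

/-- The only discontinuity of `ratio` on the quadrant is the origin. With a fixed first argument it
does no harm: if that argument is 0, the ratio vanishes identically. -/
lemma tendsto_ratio_right {ι : Type*} {l : Filter ι} {p : ℝ} {q : ι → ℝ} {q₀ : ℝ}
    (hq : Tendsto q l (𝓝 q₀)) (hp : 0 ≤ p) (hq₀ : 0 ≤ q₀) :
    Tendsto (fun i => ratio p (q i)) l (𝓝 (ratio p q₀)) := by
  rcases hp.eq_or_lt with rfl | hp
  · simpa [ratio_zero_left] using tendsto_const_nhds
  · exact tendsto_ratio tendsto_const_nhds hq hp hq₀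

/-- When both arguments move, the factor `p₀` removes the discontinuity at the origin. Such a factor
is present in the limit, as the conditional probability of the observation type. -/
lemma tendsto_mul_ratio {ι : Type*} {l : Filter ι} {p q : ι → ℝ} {p₀ q₀ : ℝ}
    (hp : Tendsto p l (𝓝 p₀)) (hq : Tendsto q l (𝓝 q₀)) (hp₀ : 0 ≤ p₀) (hq₀ : 0 ≤ q₀) :
    Tendsto (fun i => p₀ * ratio (p i) (q i)) l (𝓝 (p₀ * ratio p₀ q₀)) := by
  rcases hp₀.eq_or_lt with rfl | h
  · simpa using tendsto_const_nhds
  · exact (tendsto_ratio hp hq h hq₀).const_mul _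

/-- After multiplication by `p + q` the difference of the two sides is `(p - q) ^ 2 * (2 - (p + q))
/ 4`. Over the outcomes of a probability vector the linear terms cancel, and the squares measure the
distance. -/
lemma mul_ratio_ge {p q : ℝ} (hp : 0 ≤ p) (hp1 : p ≤ 1) (hq : 0 ≤ q) (hq1 : q ≤ 1) :
    p + (p - q) / 2 + (p - q) ^ 2 / 4 ≤ p * ratio p q := by
  rcases (add_nonneg hp hq).eq_or_lt with h | h
  · have : p = 0 := by linarith
    have : q = 0 := by linarith
    subst_vars; simp
  · unfold ratio
    rw [mul_div_assoc', le_div_iff₀ h]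
    nlinarith [mul_nonneg (sq_nonneg (p - q)) (by linarith : 0 ≤ 2 - (p + q))]

/-- This is `log x ≤ x - 1` at `x = q / ((p + q) / 2) = 2 - ratio p q`. For `q = 0` the right side
is infinite. -/
lemma negLog_add_ratio_le {p q : ℝ} (hp : 0 ≤ p) (hp1 : p ≤ 1) (hq : 0 ≤ q) (hq1 : q ≤ 1) :
    negLog ((p + q) / 2) + ENNReal.ofReal (ratio p q) ≤ negLog q + 1 := by
  rcases hq.eq_or_lt with rfl | hq
  · simp [negLog]
  · have h : 0 < (p + q) / 2 := by linarith
    unfold negLog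
    rw [if_pos h, if_pos hq, ← ENNReal.ofReal_one,
      ← ENNReal.ofReal_add (neg_nonneg.2 (Real.log_nonpos h.le (by linarith)))
        (ratio_nonneg hp hq.le),
      ← ENNReal.ofReal_add (neg_nonneg.2 (Real.log_nonpos hq.le hq1)) zero_le_one]
    apply ENNReal.ofReal_le_ofReal
    have h1 := Real.log_le_sub_one_of_pos (div_pos hq h)
    rw [Real.log_div hq.ne' h.ne'] at h1
    have h2 : q / ((p + q) / 2) = 2 - ratio p q := by
      unfold ratio
      have : p + q ≠ 0 := by linarith
      field_simp; ring
    linarith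

lemma negLog_le {y c : ℝ} (hc : 0 < c) (h : c ≤ y) :
    negLog y ≤ ENNReal.ofReal (-Real.log c) := by
  unfold negLog
  rw [if_pos (hc.trans_le h)]
  exact ENNReal.ofReal_le_ofReal (neg_le_neg (Real.log_le_log hc h))

@[fun_prop]
lemma measurable_ratio : Measurable fun x : ℝ × ℝ => ratio x.1 x.2 := by
  unfold ratio; fun_prop

/-- The pointwise inequality between the log likelihood at `q` and at the midpoint of `p` and `q`,
integrated. -/
lemma lintegral_negLog_add_ratio_le {S : Type*} [MeasurableSpace S] {μ : Measure S} {h p q : S → ℝ}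
    (hh : AEMeasurable h μ) (hp : AEMeasurable p μ) (hq : AEMeasurable q μ)
    (hb : ∀ᵐ s ∂μ, 0 < h s → p s ∈ Icc (0 : ℝ) 1 ∧ q s ∈ Icc (0 : ℝ) 1) :
    ∫⁻ s, ENNReal.ofReal (h s) * negLog ((p s + q s) / 2) ∂μ +
        ∫⁻ s, ENNReal.ofReal (h s) * ENNReal.ofReal (ratio (p s) (q s)) ∂μ ≤
      ∫⁻ s, ENNReal.ofReal (h s) * negLog (q s) ∂μ + ∫⁻ s, ENNReal.ofReal (h s) ∂μ := by
  have hr : AEMeasurable (fun s => ratio (p s) (q s)) μ :=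
    measurable_ratio.comp_aemeasurable (hp.prodMk hq)
  have hm : AEMeasurable
      (fun s => ENNReal.ofReal (h s) * ENNReal.ofReal (ratio (p s) (q s))) μ :=
    hh.ennreal_ofReal.mul hr.ennreal_ofReal
  rw [← lintegral_add_right' _ hm, ← lintegral_add_right' _ hh.ennreal_ofReal]
  refine lintegral_mono_ae ?_
  filter_upwards [hb] with s hs
  rcases le_or_gt (h s) 0 with h0 | h0
  · simp [ENNReal.ofReal_of_nonpos h0]
  · obtain ⟨⟨p0, p1⟩, q0, q1⟩ := hs h0
    calc _ = ENNReal.ofReal (h s) *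
          (negLog ((p s + q s) / 2) + ENNReal.ofReal (ratio (p s) (q s))) := by rw [mul_add]
      _ ≤ ENNReal.ofReal (h s) * (negLog (q s) + 1) :=
        mul_le_mul' le_rfl (negLog_add_ratio_le p0 p1 q0 q1)
      _ = _ := by rw [mul_add, mul_one]


/-! ### Rescaled kernels as probability densities -/

/-- The rescaled kernel `K_b (s - x)`. -/
noncomputable def scaled (K : ℝ → ℝ) (b s x : ℝ) : ℝ := K ((s - x) / b) / b

section Scaled

variable {K : ℝ → ℝ} {b : ℝ}

lemma IsKernel.continuous (hK : IsKernel K) : Continuous K := hK.contDiff.continuous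

lemma IsKernel.hasCompactSupport (hK : IsKernel K) : HasCompactSupport K :=
  HasCompactSupport.of_support_subset_isCompact isCompact_Icc hK.support_subset

lemma scaled_nonneg (hK : IsKernel K) (hb : 0 < b) (s x : ℝ) : 0 ≤ scaled K b s x :=
  div_nonneg (hK.nonneg _) hb.le

lemma abs_sub_le_of_scaled_ne_zero (hK : IsKernel K) (hb : 0 < b) {s x : ℝ}
    (h : scaled K b s x ≠ 0) : |s - x| ≤ b := by
  have h1 : K ((s - x) / b) ≠ 0 := fun h0 => h (by simp [scaled, h0])
  have h2 := abs_le.2 (hK.support_subset h1)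
  rwa [abs_div, abs_of_pos hb, div_le_one hb] at h2

lemma integrable_scaled (hK : IsKernel K) (hb : 0 < b) (x : ℝ) :
    Integrable fun s => scaled K b s x := by
  have h : Integrable K volume := hK.continuous.integrable_of_hasCompactSupport hK.hasCompactSupport
  exact ((h.comp_div hb.ne').comp_sub_right x).div_const b

lemma integral_scaled (hK : IsKernel K) (hb : 0 < b) (x : ℝ) : ∫ s, scaled K b s x = 1 := by
  unfold scaled
  rw [integral_div, integral_sub_right_eq_self (μ := volume) (fun s => K (s / b)) x,
    Measure.integral_comp_div, hK.integral_eq_one]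
  simp [abs_of_pos hb, hb.ne']

lemma setIntegral_scaled (hK : IsKernel K) (hb : 0 < b) {x M : ℝ} (hx : x ∈ Icc b (M - b)) :
    ∫ s in Icc 0 M, scaled K b s x = 1 := by
  rw [setIntegral_eq_integral_of_forall_compl_eq_zero, integral_scaled hK hb]
  intro s hs
  by_contra h
  have := abs_le.1 (abs_sub_le_of_scaled_ne_zero hK hb h)
  exact hs ⟨by linarith [hx.1], by linarith [hx.2]⟩

end Scaled

/-- The total mass of a nonnegative combination of probability densities. -/
lemma lintegral_ofReal_sum_density {S : Type*} [MeasurableSpace S] {μ : Measure S} {n : ℕ}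
    {κ : ℕ → S → ℝ} {c : ℕ → ℝ} (hc : ∀ i, 0 ≤ c i) (hκ : ∀ i s, 0 ≤ κ i s)
    (hint : ∀ i, Integrable (κ i) μ) (hone : ∀ i, c i ≠ 0 → ∫ s, κ i s ∂μ = 1) :
    ∫⁻ s, ENNReal.ofReal ((1 / (n : ℝ)) * ∑ i ∈ Finset.range n, c i * κ i s) ∂μ =
      ENNReal.ofReal ((1 / (n : ℝ)) * ∑ i ∈ Finset.range n, c i) := by
  rw [← ofReal_integral_eq_lintegral_ofReal]
  · rw [integral_const_mul, integral_finsetSum _ fun i _ => (hint i).const_mul _]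
    congr 2
    refine Finset.sum_congr rfl fun i _ => ?_
    rw [integral_const_mul]
    by_cases h : c i = 0
    · simp [h]
    · rw [hone i h, mul_one]
  · exact (integrable_finsetSum _ fun i _ => (hint i).const_mul _).const_mul _
  · exact ae_of_all _ fun s => mul_nonneg (by positivity)
      (Finset.sum_nonneg fun i _ => mul_nonneg (hc i) (hκ i s))

/-! ### Boundary weights and bounds for smoothed averages -/

/-- A bound for the absolute mass that the weights give to an observation `x`. -/
noncomputable def edgeFactor (C δ M x : ℝ) : ℝ :=
  -- The boundary strip and the kernel radius each have size at most `δ`, so an observation in this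
  -- interval meets no boundary weight. The summand 1 keeps the factor at least 1.
  if x ∈ Icc (2 * δ) (M - 2 * δ) then 1 else 1 + 2 * C

lemma one_le_edgeFactor {C : ℝ} (hC : 0 ≤ C) (δ M x : ℝ) : 1 ≤ edgeFactor C δ M x := by
  unfold edgeFactor; split_ifs <;> linarith

lemma edgeFactor_le {C : ℝ} (hC : 0 ≤ C) (δ M x : ℝ) : edgeFactor C δ M x ≤ 1 + 2 * C := by
  unfold edgeFactor; split_ifs <;> linarith

lemma measurable_edgeFactor (C δ M : ℝ) : Measurable (edgeFactor C δ M) :=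
  Measurable.ite measurableSet_Icc measurable_const measurable_const

section Weight

variable {K α β : ℝ → ℝ} {M b δ C : ℝ}

lemma weight_eq_scaled (hbδ : b ≤ δ) {s : ℝ} (hs : s ∈ Icc δ (M - δ)) (x : ℝ) :
    weight K α β M b s x = scaled K b s x := by
  unfold weight
  rw [if_neg (by linarith [hs.1]), if_neg (by linarith [hs.2]), scaled]

lemma abs_boundary_le {k z p q : ℝ} (hk : 0 ≤ k) (hz : k ≠ 0 → |z| ≤ 1) (hp : |p| ≤ C)
    (hq : |q| ≤ C) : |p * k + q * (z * k)| ≤ 2 * C * k := by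
  have hC : 0 ≤ C := (abs_nonneg p).trans hp
  rcases eq_or_ne k 0 with rfl | h
  · simp
  · have h1 : |q * z| ≤ C * 1 := by
      rw [abs_mul]; exact mul_le_mul hq (hz h) (abs_nonneg _) hC
    calc |p * k + q * (z * k)| = |p + q * z| * k := by
          rw [show p * k + q * (z * k) = (p + q * z) * k by ring, abs_mul, abs_of_nonneg hk]
      _ ≤ (|p| + |q * z|) * k := by gcongr; exact abs_add_le _ _
      _ ≤ 2 * C * k := by gcongr; linarith

lemma abs_weight_le (hK : IsKernel K) (hC : ∀ u ∈ Icc (0 : ℝ) 1, |α u| ≤ C ∧ |β u| ≤ C)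
    (hb : 0 < b) (hbδ : b ≤ δ) {s : ℝ} (hs : s ∈ Icc 0 M) (x : ℝ) :
    |weight K α β M b s x| ≤ edgeFactor C δ M x * scaled K b s x := by
  have hC0 : 0 ≤ C := (abs_nonneg _).trans (hC 0 (by simp)).1
  have hk := scaled_nonneg hK hb s x
  have hz : scaled K b s x ≠ 0 → |(s - x) / b| ≤ 1 := fun h => by
    rw [abs_div, abs_of_pos hb, div_le_one hb]; exact abs_sub_le_of_scaled_ne_zero hK hb h
  -- In the boundary strip the kernel vanishes for observations in the inner interval, and for the
  -- others the factor `1 + 2 * C` exceeds `2 * C`.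
  have hedge : ∀ w, |w| ≤ 2 * C * scaled K b s x → (s < b ∨ M - b < s) →
      |w| ≤ edgeFactor C δ M x * scaled K b s x := by
    intro w hw hsb
    unfold edgeFactor
    split_ifs with hx
    · have h0 : scaled K b s x = 0 := by
        by_contra h
        have := abs_le.1 (abs_sub_le_of_scaled_ne_zero hK hb h)
        rcases hsb with h | h <;> linarith [hx.1, hx.2]
      simpa [h0] using hw
    · linarith
  unfold weight
  split_ifs with h1 h2
  · refine hedge _ ?_ (Or.inl h1)
    have := hC (s / b) ⟨div_nonneg hs.1 hb.le, by rw [div_le_one hb]; exact h1.le⟩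
    exact abs_boundary_le hk hz this.1 this.2
  · refine hedge _ ?_ (Or.inr h2)
    have := hC ((M - s) / b)
      ⟨div_nonneg (by linarith [hs.2]) hb.le, by rw [div_le_one hb]; linarith⟩
    have h := abs_boundary_le hk hz this.1 ((abs_neg (β ((M - s) / b))).trans_le this.2)
    rw [neg_mul] at h
    exact h
  · change |scaled K b s x| ≤ _
    rw [abs_of_nonneg hk]
    exact le_mul_of_one_le_left hk (one_le_edgeFactor hC0 _ _ _)

/-- Nothing is known of `α` and `β` off `[0, 1]`. Their constant extensions are continuous and give
the same weight on `[0, M]`, where the coefficients are evaluated only inside `[0, 1]`. -/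
lemma aemeasurable_weight (hK : IsKernel K) (hα : ContinuousOn α (Icc 0 1))
    (hβ : ContinuousOn β (Icc 0 1)) (hb : 0 < b) (x : ℝ) :
    AEMeasurable (fun s => weight K α β M b s x) (volume.restrict (Icc 0 M)) := by
  have hα' : Continuous (IccExtend (zero_le_one' ℝ) (domRestrict (Icc 0 1) α)) :=
    (continuousOn_iff_continuous_domRestrict.1 hα).Icc_extend'
  have hβ' : Continuous (IccExtend (zero_le_one' ℝ) (domRestrict (Icc 0 1) β)) :=
    (continuousOn_iff_continuous_domRestrict.1 hβ).Icc_extend'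
  have := hK.continuous
  refine ⟨fun s => weight K (IccExtend (zero_le_one' ℝ) (domRestrict (Icc 0 1) α))
    (IccExtend (zero_le_one' ℝ) (domRestrict (Icc 0 1) β)) M b s x, ?_, ?_⟩
  · unfold weight
    exact Measurable.ite measurableSet_Iio (by fun_prop)
      (Measurable.ite measurableSet_Ioi (by fun_prop) (by fun_prop))
  · refine ae_restrict_of_forall_mem measurableSet_Icc fun s hs => ?_
    have e : ∀ (f : ℝ → ℝ) (y : ℝ), y ∈ Icc (0 : ℝ) 1 →
        IccExtend (zero_le_one' ℝ) (domRestrict (Icc 0 1) f) y = f y := fun f y hy => by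
      rw [IccExtend_of_mem _ _ hy]; rfl
    simp only [weight]
    split_ifs with h1 h2
    · have hm : s / b ∈ Icc (0 : ℝ) 1 :=
        ⟨div_nonneg hs.1 hb.le, by rw [div_le_one hb]; exact h1.le⟩
      rw [e _ _ hm, e _ _ hm]
    · have hm : (M - s) / b ∈ Icc (0 : ℝ) 1 :=
        ⟨div_nonneg (by linarith [hs.2]) hb.le, by rw [div_le_one hb]; linarith⟩
      rw [e _ _ hm, e _ _ hm]
    · rfl

/-- The positive part of the weighted kernel average at `s`; the raw estimates are special cases. -/
noncomputable def smooth (w : ℝ → ℝ → ℝ) (n : ℕ) (d t : ℕ → ℝ) (s : ℝ) : ℝ :=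
  max 0 ((1 / (n : ℝ)) * ∑ i ∈ Finset.range n, w s (t i) * d i)

/-- The bivariate version of `smooth`. -/
noncomputable def smooth₂ (w : ℝ → ℝ → ℝ) (n : ℕ) (d t u : ℕ → ℝ) (p : ℝ × ℝ) : ℝ :=
  max 0 ((1 / (n : ℝ)) * ∑ i ∈ Finset.range n, w p.1 (t i) * w p.2 (u i) * d i)

lemma smooth_nonneg (w : ℝ → ℝ → ℝ) (n : ℕ) (d t : ℕ → ℝ) (s : ℝ) : 0 ≤ smooth w n d t s :=
  le_max_left _ _

lemma smooth₂_nonneg (w : ℝ → ℝ → ℝ) (n : ℕ) (d t u : ℕ → ℝ) (p : ℝ × ℝ) :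
    0 ≤ smooth₂ w n d t u p :=
  le_max_left _ _

variable {n : ℕ} {d t u : ℕ → ℝ}

lemma aemeasurable_smooth (hK : IsKernel K) (hα : ContinuousOn α (Icc 0 1))
    (hβ : ContinuousOn β (Icc 0 1)) (hb : 0 < b) :
    AEMeasurable (smooth (weight K α β M b) n d t) (volume.restrict (Icc 0 M)) := by
  unfold smooth
  refine aemeasurable_const.max (AEMeasurable.const_mul ?_ _)
  exact Finset.aemeasurable_fun_sum _ fun i _ =>
    (aemeasurable_weight hK hα hβ hb _).mul_const _

lemma aemeasurable_smooth₂ (hK : IsKernel K) (hα : ContinuousOn α (Icc 0 1))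
    (hβ : ContinuousOn β (Icc 0 1)) (hb : 0 < b) :
    AEMeasurable (smooth₂ (weight K α β M b) n d t u)
      (volume.restrict (Icc (0 : ℝ) M ×ˢ Icc (0 : ℝ) M)) := by
  unfold smooth₂
  rw [Measure.volume_eq_prod, ← Measure.prod_restrict]
  refine aemeasurable_const.max (AEMeasurable.const_mul ?_ _)
  exact Finset.aemeasurable_fun_sum _ fun i _ =>
    ((aemeasurable_weight hK hα hβ hb _).comp_fst.mul
      (aemeasurable_weight hK hα hβ hb _).comp_snd).mul_const _

/-- The weights are dominated by `edgeFactor` times a kernel of mass one, and enlarging the domain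
from `[0, M]` to the line only adds mass. -/
lemma lintegral_smooth_le (hK : IsKernel K)
    (hC : ∀ u ∈ Icc (0 : ℝ) 1, |α u| ≤ C ∧ |β u| ≤ C) (hb : 0 < b) (hbδ : b ≤ δ)
    (hd : ∀ i, 0 ≤ d i) :
    ∫⁻ s in Icc 0 M, ENNReal.ofReal (smooth (weight K α β M b) n d t s) ≤
      ENNReal.ofReal ((1 / (n : ℝ)) * ∑ i ∈ Finset.range n, edgeFactor C δ M (t i) * d i) := by
  have hC0 : 0 ≤ C := (abs_nonneg _).trans (hC 0 (by simp)).1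
  have hρ : ∀ x, 0 ≤ edgeFactor C δ M x := fun x => zero_le_one.trans (one_le_edgeFactor hC0 _ _ _)
  have hc : ∀ i, 0 ≤ edgeFactor C δ M (t i) * d i := fun i => mul_nonneg (hρ _) (hd i)
  rw [← lintegral_ofReal_sum_density (μ := volume) (κ := fun i s => scaled K b s (t i)) hc
    (fun i s => scaled_nonneg hK hb _ _) (fun i => integrable_scaled hK hb _)
    (fun i _ => integral_scaled hK hb _)]
  refine le_trans (setLIntegral_mono' measurableSet_Icc fun s hs => ?_)
    (setLIntegral_le_lintegral (Icc 0 M) _)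
  refine ENNReal.ofReal_le_ofReal (max_le ?_ ?_)
  · exact mul_nonneg (by positivity)
      (Finset.sum_nonneg fun i _ => mul_nonneg (hc i) (scaled_nonneg hK hb _ _))
  · refine mul_le_mul_of_nonneg_left (Finset.sum_le_sum fun i _ => ?_) (by positivity)
    have := (le_abs_self _).trans (abs_weight_le hK hC hb hbδ hs (t i))
    calc _ ≤ edgeFactor C δ M (t i) * scaled K b s (t i) * d i :=
          mul_le_mul_of_nonneg_right this (hd i)
      _ = _ := by ring

lemma lintegral_smooth₂_le (hK : IsKernel K)
    (hC : ∀ u ∈ Icc (0 : ℝ) 1, |α u| ≤ C ∧ |β u| ≤ C) (hb : 0 < b) (hbδ : b ≤ δ)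
    (hd : ∀ i, 0 ≤ d i) :
    ∫⁻ p in Icc (0 : ℝ) M ×ˢ Icc (0 : ℝ) M,
        ENNReal.ofReal (smooth₂ (weight K α β M b) n d t u p) ≤
      ENNReal.ofReal ((1 / (n : ℝ)) *
        ∑ i ∈ Finset.range n, edgeFactor C δ M (t i) * edgeFactor C δ M (u i) * d i) := by
  have hC0 : 0 ≤ C := (abs_nonneg _).trans (hC 0 (by simp)).1
  have hρ : ∀ x, 0 ≤ edgeFactor C δ M x := fun x => zero_le_one.trans (one_le_edgeFactor hC0 _ _ _)
  have hc : ∀ i, 0 ≤ edgeFactor C δ M (t i) * edgeFactor C δ M (u i) * d i :=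
    fun i => mul_nonneg (mul_nonneg (hρ _) (hρ _)) (hd i)
  rw [← lintegral_ofReal_sum_density (μ := (volume : Measure (ℝ × ℝ)))
    (κ := fun i p => scaled K b p.1 (t i) * scaled K b p.2 (u i)) hc
    (fun i s => mul_nonneg (scaled_nonneg hK hb _ _) (scaled_nonneg hK hb _ _))
    (fun i => (integrable_scaled hK hb _).mul_prod (integrable_scaled hK hb _))
    (fun i _ => by
      rw [Measure.volume_eq_prod, integral_prod_mul (fun s => scaled K b s (t i))
        (fun s => scaled K b s (u i)), integral_scaled hK hb, integral_scaled hK hb, mul_one])]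
  refine le_trans (setLIntegral_mono' (measurableSet_Icc.prod measurableSet_Icc) fun p hp => ?_)
    (setLIntegral_le_lintegral (Icc (0 : ℝ) M ×ˢ Icc (0 : ℝ) M) _)
  refine ENNReal.ofReal_le_ofReal (max_le ?_ ?_)
  · exact mul_nonneg (by positivity) (Finset.sum_nonneg fun i _ =>
      mul_nonneg (hc i) (mul_nonneg (scaled_nonneg hK hb _ _) (scaled_nonneg hK hb _ _)))
  · refine mul_le_mul_of_nonneg_left (Finset.sum_le_sum fun i _ => ?_) (by positivity)
    have h1 := abs_weight_le hK hC hb hbδ hp.1 (t i)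
    have h2 := abs_weight_le hK hC hb hbδ hp.2 (u i)
    have h3 := (le_abs_self _).trans ((abs_mul _ _).trans_le
      (mul_le_mul h1 h2 (abs_nonneg _) (mul_nonneg (hρ _) (scaled_nonneg hK hb _ _))))
    calc _ ≤ _ := mul_le_mul_of_nonneg_right h3 (hd i)
      _ = _ := by ring

/-- `e i` bounds `d i * φ` below on the window of an inner observation. That window lies in `[δ, M -
δ]`, where the weight is the plain kernel of mass one; elsewhere the integrand is merely
nonnegative. -/
lemma le_lintegral_smooth_mul (hK : IsKernel K) (hb : 0 < b) (hbδ : b ≤ δ) {φ : ℝ → ℝ}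
    {e : ℕ → ℝ} (hd : ∀ i, 0 ≤ d i) (he : ∀ i, 0 ≤ e i) (hφ : ∀ s ∈ Icc 0 M, 0 ≤ φ s)
    (h : ∀ i, e i ≠ 0 → t i ∈ Icc (2 * δ) (M - 2 * δ) ∧
      ∀ s ∈ Icc 0 M, |s - t i| ≤ b → e i ≤ d i * φ s) :
    ENNReal.ofReal ((1 / (n : ℝ)) * ∑ i ∈ Finset.range n, e i) ≤
      ∫⁻ s in Icc 0 M, ENNReal.ofReal (smooth (weight K α β M b) n d t s) *
        ENNReal.ofReal (φ s) := by
  have hδ : 0 < δ := hb.trans_le hbδ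
  rw [← lintegral_ofReal_sum_density (μ := volume.restrict (Icc 0 M))
    (κ := fun i s => scaled K b s (t i)) he
    (fun i s => scaled_nonneg hK hb _ _) (fun i => (integrable_scaled hK hb _).restrict)
    (fun i hi => setIntegral_scaled hK hb
      ⟨by linarith [(h i hi).1.1], by linarith [(h i hi).1.2]⟩)]
  refine setLIntegral_mono' measurableSet_Icc fun s hs => ?_
  rw [← ENNReal.ofReal_mul (smooth_nonneg _ _ _ _ _)]
  refine ENNReal.ofReal_le_ofReal ?_
  by_cases hsδ : s ∈ Icc δ (M - δ)
  · refine le_trans ?_ (mul_le_mul_of_nonneg_right (le_max_right _ _) (hφ s hs))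
    rw [mul_assoc, Finset.sum_mul]
    refine mul_le_mul_of_nonneg_left (Finset.sum_le_sum fun i _ => ?_) (by positivity)
    rw [weight_eq_scaled hbδ hsδ]
    have hk := scaled_nonneg hK hb s (t i)
    by_cases hi : e i = 0
    · rw [hi, zero_mul]; exact mul_nonneg (mul_nonneg hk (hd i)) (hφ s hs)
    by_cases hki : scaled K b s (t i) = 0
    · simp [hki]
    · have := (h i hi).2 s hs (abs_sub_le_of_scaled_ne_zero hK hb hki)
      nlinarith
  · rw [Finset.sum_eq_zero, mul_zero]
    · exact mul_nonneg (smooth_nonneg _ _ _ _ _) (hφ s hs)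
    · intro i _
      by_contra h0
      have := abs_le.1 (abs_sub_le_of_scaled_ne_zero hK hb (right_ne_zero_of_mul h0))
      have h1 := (h i (left_ne_zero_of_mul h0)).1
      exact hsδ ⟨by linarith [h1.1], by linarith [h1.2]⟩

lemma le_lintegral_smooth₂_mul (hK : IsKernel K) (hb : 0 < b) (hbδ : b ≤ δ) {φ : ℝ × ℝ → ℝ}
    {e : ℕ → ℝ} (hd : ∀ i, 0 ≤ d i) (he : ∀ i, 0 ≤ e i)
    (hφ : ∀ i, e i ≠ 0 → t i ∈ Icc (2 * δ) (M - 2 * δ) ∧ u i ∈ Icc (2 * δ) (M - 2 * δ) ∧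
      ∀ r ∈ Icc 0 M, ∀ s ∈ Icc 0 M, |r - t i| ≤ b → |s - u i| ≤ b → e i ≤ d i * φ (r, s))
    (hφ0 : ∀ i, d i ≠ 0 → ∀ r ∈ Icc 0 M, ∀ s ∈ Icc 0 M, |r - t i| ≤ b → |s - u i| ≤ b →
      0 ≤ φ (r, s)) :
    ENNReal.ofReal ((1 / (n : ℝ)) * ∑ i ∈ Finset.range n, e i) ≤
      ∫⁻ p in Icc (0 : ℝ) M ×ˢ Icc (0 : ℝ) M,
        ENNReal.ofReal (smooth₂ (weight K α β M b) n d t u p) * ENNReal.ofReal (φ p) := by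
  have hδ : 0 < δ := hb.trans_le hbδ
  rw [← lintegral_ofReal_sum_density
    (μ := volume.restrict (Icc (0 : ℝ) M ×ˢ Icc (0 : ℝ) M))
    (κ := fun i p => scaled K b p.1 (t i) * scaled K b p.2 (u i)) he
    (fun i s => mul_nonneg (scaled_nonneg hK hb _ _) (scaled_nonneg hK hb _ _))
    (fun i => ((integrable_scaled hK hb _).mul_prod (integrable_scaled hK hb _)).restrict)
    (fun i hi => by
      rw [Measure.volume_eq_prod, setIntegral_prod_mul (fun s => scaled K b s (t i))
        (fun s => scaled K b s (u i)), setIntegral_scaled hK hb, setIntegral_scaled hK hb, mul_one]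
      · exact ⟨by linarith [(hφ i hi).2.1.1], by linarith [(hφ i hi).2.1.2]⟩
      · exact ⟨by linarith [(hφ i hi).1.1], by linarith [(hφ i hi).1.2]⟩)]
  refine setLIntegral_mono' (measurableSet_Icc.prod measurableSet_Icc) fun p hp => ?_
  rw [← ENNReal.ofReal_mul (smooth₂_nonneg _ _ _ _ _ _)]
  by_cases hsδ : p.1 ∈ Icc δ (M - δ) ∧ p.2 ∈ Icc δ (M - δ)
  · have hk : ∀ i, 0 ≤ scaled K b p.1 (t i) * scaled K b p.2 (u i) := fun i =>
      mul_nonneg (scaled_nonneg hK hb _ _) (scaled_nonneg hK hb _ _)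
    have hS : 0 ≤ (1 / (n : ℝ)) *
        ∑ i ∈ Finset.range n, scaled K b p.1 (t i) * scaled K b p.2 (u i) * d i :=
      mul_nonneg (by positivity) (Finset.sum_nonneg fun i _ => mul_nonneg (hk i) (hd i))
    -- An equality, not only a bound for the positive part: `φ p` has no known sign when no relevant
    -- observation is near `p`, so an inequality could not be multiplied by it.
    have heq : smooth₂ (weight K α β M b) n d t u p = (1 / (n : ℝ)) *
        ∑ i ∈ Finset.range n, scaled K b p.1 (t i) * scaled K b p.2 (u i) * d i := by
      unfold smooth₂
      simp_rw [weight_eq_scaled hbδ hsδ.1, weight_eq_scaled hbδ hsδ.2]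
      exact max_eq_right hS
    rw [heq, mul_assoc, Finset.sum_mul]
    refine ENNReal.ofReal_le_ofReal ?_
    refine mul_le_mul_of_nonneg_left (Finset.sum_le_sum fun i _ => ?_) (by positivity)
    by_cases hki : scaled K b p.1 (t i) * scaled K b p.2 (u i) = 0
    · simp [hki]
    have n1 := abs_sub_le_of_scaled_ne_zero hK hb (left_ne_zero_of_mul hki)
    have n2 := abs_sub_le_of_scaled_ne_zero hK hb (right_ne_zero_of_mul hki)
    by_cases hi : e i = 0
    · rw [hi, zero_mul]
      by_cases hdi : d i = 0
      · simp [hdi]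
      · exact mul_nonneg (mul_nonneg (hk i) (hd i)) (hφ0 i hdi _ hp.1 _ hp.2 n1 n2)
    · have h1 := (hφ i hi).2.2 _ hp.1 _ hp.2 n1 n2
      have h2 := hk i
      nlinarith
  · rw [Finset.sum_eq_zero, mul_zero, ENNReal.ofReal_zero]
    · exact zero_le
    · intro i _
      by_contra h0
      have hk := right_ne_zero_of_mul h0
      have n1 := abs_le.1 (abs_sub_le_of_scaled_ne_zero hK hb (left_ne_zero_of_mul hk))
      have n2 := abs_le.1 (abs_sub_le_of_scaled_ne_zero hK hb (right_ne_zero_of_mul hk))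
      obtain ⟨h1, h2, _⟩ := hφ i (left_ne_zero_of_mul h0)
      exact hsδ ⟨⟨by linarith [h1.1], by linarith [h1.2]⟩, by linarith [h2.1], by linarith [h2.2]⟩

end Weight


/-! ### Comparison of a maximizer with a midpoint -/

section Likelihood

variable {M : ℝ} {h₁ h₂ : ℝ → ℝ} {h : ℝ → ℝ → ℝ} {F G : ℝ → ℝ}

/-- The negative of `logLik`. -/
noncomputable def negLogLik (M : ℝ) (h₁ h₂ : ℝ → ℝ) (h : ℝ → ℝ → ℝ) (F : ℝ → ℝ) : ℝ≥0∞ :=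
  (∫⁻ t in Icc 0 M, ENNReal.ofReal (h₁ t) * negLog (F t)) +
    (∫⁻ u in Icc 0 M, ENNReal.ofReal (h₂ u) * negLog (1 - F u)) +
    ∫⁻ p in Icc (0 : ℝ) M ×ˢ Icc (0 : ℝ) M,
      ENNReal.ofReal (h p.1 p.2) * negLog (F p.2 - F p.1)

lemma IsMaximizer.negLogLik_le (hF : IsMaximizer M h₁ h₂ h F) (hG : IsDistFun M G) :
    negLogLik M h₁ h₂ h F ≤ negLogLik M h₁ h₂ h G := by
  have := hF.2 G hG
  unfold logLik at this
  rwa [EReal.neg_le_neg_iff, EReal.coe_ennreal_le_coe_ennreal_iff] at this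

lemma IsDistFun.midpoint (hF : IsDistFun M F) (hG : IsDistFun M G) :
    IsDistFun M fun t => (F t + G t) / 2 where
  mono x hx y hy hxy := by
    have := hF.mono hx hy hxy
    have := hG.mono hx hy hxy
    change (F x + G x) / 2 ≤ (F y + G y) / 2
    linarith
  right_cont t ht := ((hF.right_cont t ht).add (hG.right_cont t ht)).div_const 2
  mem_unit t ht := by
    have h1 := hF.mem_unit t ht
    have h2 := hG.mem_unit t ht
    exact ⟨by linarith [h1.1, h2.1], by linarith [h1.2, h2.2]⟩

/-- This competitor has finite likelihood: it stays in `[1/4, 3/4]`, and its increments are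
proportional to length, hence bounded below where `h` is positive. -/
lemma isDistFun_linear (hM : 0 < M) : IsDistFun M fun t => 1 / 4 + t / (2 * M) where
  mono x _ y _ hxy := by
    change 1 / 4 + x / (2 * M) ≤ 1 / 4 + y / (2 * M)
    gcongr
  right_cont t _ := (by fun_prop : Continuous fun t : ℝ => 1 / 4 + t / (2 * M)).continuousWithinAt
  mem_unit t ht := by
    have h1 : 0 ≤ t / (2 * M) := div_nonneg ht.1 (by linarith)
    have h2 : t / (2 * M) ≤ 1 / 2 := by rw [div_le_iff₀ (by linarith)]; linarith [ht.2]
    exact ⟨by linarith, by linarith⟩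

lemma lintegral_mul_negLog_lt_top {S : Type*} [MeasurableSpace S] {μ : Measure S} {f q : S → ℝ}
    {c : ℝ} (hc : 0 < c) (hf : ∫⁻ s, ENNReal.ofReal (f s) ∂μ ≠ ⊤)
    (hq : ∀ᵐ s ∂μ, 0 < f s → c ≤ q s) :
    ∫⁻ s, ENNReal.ofReal (f s) * negLog (q s) ∂μ < ⊤ := by
  calc _ ≤ ∫⁻ s, ENNReal.ofReal (f s) * ENNReal.ofReal (-Real.log c) ∂μ := by
        refine lintegral_mono_ae ?_
        filter_upwards [hq] with s hs
        rcases le_or_gt (f s) 0 with h0 | h0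
        · simp [ENNReal.ofReal_of_nonpos h0]
        · exact mul_le_mul' le_rfl (negLog_le hc (hs h0))
    _ = (∫⁻ s, ENNReal.ofReal (f s) ∂μ) * ENNReal.ofReal (-Real.log c) :=
        lintegral_mul_const' _ _ ENNReal.ofReal_ne_top
    _ < ⊤ := ENNReal.mul_lt_top hf.lt_top ENNReal.ofReal_lt_top

lemma negLogLik_linear_lt_top (hM : 0 < M) {η : ℝ} (hη : 0 < η)
    (hf₁ : ∫⁻ s in Icc 0 M, ENNReal.ofReal (h₁ s) ≠ ⊤)
    (hf₂ : ∫⁻ s in Icc 0 M, ENNReal.ofReal (h₂ s) ≠ ⊤)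
    (hf : ∫⁻ p in Icc (0 : ℝ) M ×ˢ Icc (0 : ℝ) M, ENNReal.ofReal (h p.1 p.2) ≠ ⊤)
    (hsep : ∀ r ∈ Icc 0 M, ∀ s ∈ Icc 0 M, 0 < h r s → η ≤ s - r) :
    negLogLik M h₁ h₂ h (fun t => 1 / 4 + t / (2 * M)) < ⊤ := by
  refine ENNReal.add_lt_top.2 ⟨ENNReal.add_lt_top.2 ⟨?_, ?_⟩, ?_⟩
  · refine lintegral_mul_negLog_lt_top (c := 1 / 4) (by norm_num) hf₁
      (ae_restrict_of_forall_mem measurableSet_Icc fun s hs _ => ?_)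
    have : 0 ≤ s / (2 * M) := div_nonneg hs.1 (by linarith)
    linarith
  · refine lintegral_mul_negLog_lt_top (c := 1 / 4) (by norm_num) hf₂
      (ae_restrict_of_forall_mem measurableSet_Icc fun s hs _ => ?_)
    have : s / (2 * M) ≤ 1 / 2 := by rw [div_le_iff₀ (by linarith)]; linarith [hs.2]
    linarith
  · refine lintegral_mul_negLog_lt_top (c := η / (2 * M)) (by positivity) hf
      (ae_restrict_of_forall_mem (measurableSet_Icc.prod measurableSet_Icc) fun p hp h0 => ?_)
    have := hsep _ hp.1 _ hp.2 h0
    rw [add_sub_add_left_eq_sub, ← sub_div]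
    gcongr

/-- Here `a` and `q` are the negative log likelihoods of the midpoint and of the maximizer.
Cancelling `a` needs its finiteness, which the summed inequalities supply. -/
lemma add_le_add_of_cancel {a₁ a₂ a₃ r₁ r₂ r₃ q₁ q₂ q₃ m₁ m₂ m₃ : ℝ≥0∞}
    (h₁ : a₁ + r₁ ≤ q₁ + m₁) (h₂ : a₂ + r₂ ≤ q₂ + m₂) (h₃ : a₃ + r₃ ≤ q₃ + m₃)
    (hqa : q₁ + q₂ + q₃ ≤ a₁ + a₂ + a₃) (hq : q₁ + q₂ + q₃ < ⊤) (hm : m₁ + m₂ + m₃ < ⊤) :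
    r₁ + r₂ + r₃ ≤ m₁ + m₂ + m₃ := by
  have h : (a₁ + a₂ + a₃) + (r₁ + r₂ + r₃) ≤ (q₁ + q₂ + q₃) + (m₁ + m₂ + m₃) := by
    calc _ = (a₁ + r₁) + (a₂ + r₂) + (a₃ + r₃) := by ring
      _ ≤ (q₁ + m₁) + (q₂ + m₂) + (q₃ + m₃) := by gcongr
      _ = _ := by ring
  have ha : a₁ + a₂ + a₃ < ⊤ := (le_self_add.trans h).trans_lt (ENNReal.add_lt_top.2 ⟨hq, hm⟩)
  exact ENNReal.le_of_add_le_add_left ha.ne (h.trans (by gcongr))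

lemma IsDistFun.aemeasurable (hF : IsDistFun M F) :
    AEMeasurable F (volume.restrict (Icc 0 M)) :=
  aemeasurable_restrict_of_monotoneOn measurableSet_Icc hF.mono

/-- A maximizer of the likelihood satisfies a bound without singularities: the mixture of `F` with
any other (sub-)distribution function `G` is not more likely. -/
lemma IsMaximizer.lintegral_ratio_le (hF : IsMaximizer M h₁ h₂ h F) (hG : IsDistFun M G)
    (hM : 0 < M) {η : ℝ} (hη : 0 < η)
    (hm₁ : AEMeasurable h₁ (volume.restrict (Icc 0 M)))
    (hm₂ : AEMeasurable h₂ (volume.restrict (Icc 0 M)))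
    (hm : AEMeasurable (fun p : ℝ × ℝ => h p.1 p.2)
      (volume.restrict (Icc (0 : ℝ) M ×ˢ Icc (0 : ℝ) M)))
    (hf₁ : ∫⁻ s in Icc 0 M, ENNReal.ofReal (h₁ s) ≠ ⊤)
    (hf₂ : ∫⁻ s in Icc 0 M, ENNReal.ofReal (h₂ s) ≠ ⊤)
    (hf : ∫⁻ p in Icc (0 : ℝ) M ×ˢ Icc (0 : ℝ) M, ENNReal.ofReal (h p.1 p.2) ≠ ⊤)
    (hsep : ∀ r ∈ Icc 0 M, ∀ s ∈ Icc 0 M, 0 < h r s → η ≤ s - r) :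
    (∫⁻ s in Icc 0 M, ENNReal.ofReal (h₁ s) * ENNReal.ofReal (ratio (G s) (F s))) +
      (∫⁻ s in Icc 0 M, ENNReal.ofReal (h₂ s) * ENNReal.ofReal (ratio (1 - G s) (1 - F s))) +
      (∫⁻ p in Icc (0 : ℝ) M ×ˢ Icc (0 : ℝ) M, ENNReal.ofReal (h p.1 p.2) *
        ENNReal.ofReal (ratio (G p.2 - G p.1) (F p.2 - F p.1))) ≤
    (∫⁻ s in Icc 0 M, ENNReal.ofReal (h₁ s)) + (∫⁻ s in Icc 0 M, ENNReal.ofReal (h₂ s)) +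
      ∫⁻ p in Icc (0 : ℝ) M ×ˢ Icc (0 : ℝ) M, ENNReal.ofReal (h p.1 p.2) := by
  have hFd := hF.1
  have hlin := (hF.negLogLik_le (isDistFun_linear hM)).trans_lt
    (negLogLik_linear_lt_top hM hη hf₁ hf₂ hf hsep)
  have hmid := hF.negLogLik_le (hG.midpoint hFd)
  have hmeas : ∀ {f : ℝ → ℝ}, AEMeasurable f (volume.restrict (Icc 0 M)) →
      AEMeasurable (fun p : ℝ × ℝ => f p.2 - f p.1)
        (volume.restrict (Icc (0 : ℝ) M ×ˢ Icc (0 : ℝ) M)) := by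
    intro f hf
    rw [Measure.volume_eq_prod, ← Measure.prod_restrict]
    exact hf.comp_snd.sub hf.comp_fst
  have b₁ := lintegral_negLog_add_ratio_le hm₁ hG.aemeasurable hFd.aemeasurable
    (ae_restrict_of_forall_mem measurableSet_Icc fun s hs _ =>
      ⟨hG.mem_unit s hs, hFd.mem_unit s hs⟩)
  have b₂ := lintegral_negLog_add_ratio_le hm₂ (hG.aemeasurable.const_sub 1)
    (hFd.aemeasurable.const_sub 1)
    (ae_restrict_of_forall_mem measurableSet_Icc fun s hs _ => by
      have h1 := hG.mem_unit s hs
      have h2 := hFd.mem_unit s hs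
      exact ⟨⟨by linarith [h1.2], by linarith [h1.1]⟩, by linarith [h2.2], by linarith [h2.1]⟩)
  have b₃ := lintegral_negLog_add_ratio_le hm (hmeas hG.aemeasurable) (hmeas hFd.aemeasurable)
    (ae_restrict_of_forall_mem (measurableSet_Icc.prod measurableSet_Icc) fun p hp h0 => by
      have hle : p.1 ≤ p.2 := by linarith [hsep _ hp.1 _ hp.2 h0]
      have h1 := hG.mem_unit _ hp.1
      have h2 := hFd.mem_unit _ hp.1
      have h3 := hG.mem_unit _ hp.2
      have h4 := hFd.mem_unit _ hp.2
      have h5 := hG.mono hp.1 hp.2 hle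
      have h6 := hFd.mono hp.1 hp.2 hle
      exact ⟨⟨by linarith, by linarith [h1.1, h3.2]⟩, by linarith, by linarith [h2.1, h4.2]⟩)
  have e₂ : ∀ s, 1 - (G s + F s) / 2 = (1 - G s + (1 - F s)) / 2 := fun s => by ring
  have e₃ : ∀ p : ℝ × ℝ, (G p.2 + F p.2) / 2 - (G p.1 + F p.1) / 2 =
      (G p.2 - G p.1 + (F p.2 - F p.1)) / 2 := fun p => by ring
  simp only [negLogLik, e₂, e₃] at hmid hlin
  exact add_le_add_of_cancel b₁ b₂ b₃ hmid hlin (ENNReal.add_lt_top.2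
    ⟨ENNReal.add_lt_top.2 ⟨hf₁.lt_top, hf₂.lt_top⟩, hf.lt_top⟩)

/-- `IsMaximizer.lintegral_ratio_le` for unnormalized densities. -/
lemma IsMaximizer.lintegral_ratio_le_of_div {m : ℝ}
    (hF : IsMaximizer M (fun s => h₁ s / m) (fun s => h₂ s / m) (fun r s => h r s / m) F)
    (hG : IsDistFun M G) (hM : 0 < M) {η : ℝ} (hη : 0 < η)
    (hm₁ : AEMeasurable h₁ (volume.restrict (Icc 0 M)))
    (hm₂ : AEMeasurable h₂ (volume.restrict (Icc 0 M)))
    (hm : AEMeasurable (fun p : ℝ × ℝ => h p.1 p.2)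
      (volume.restrict (Icc (0 : ℝ) M ×ˢ Icc (0 : ℝ) M)))
    (hf : (∫⁻ s in Icc 0 M, ENNReal.ofReal (h₁ s)) + (∫⁻ s in Icc 0 M, ENNReal.ofReal (h₂ s)) +
      (∫⁻ p in Icc (0 : ℝ) M ×ˢ Icc (0 : ℝ) M, ENNReal.ofReal (h p.1 p.2)) = ENNReal.ofReal m)
    (hsep : ∀ r ∈ Icc 0 M, ∀ s ∈ Icc 0 M, 0 < h r s → η ≤ s - r) :
    (∫⁻ s in Icc 0 M, ENNReal.ofReal (h₁ s) * ENNReal.ofReal (ratio (G s) (F s))) +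
      (∫⁻ s in Icc 0 M, ENNReal.ofReal (h₂ s) * ENNReal.ofReal (ratio (1 - G s) (1 - F s))) +
      (∫⁻ p in Icc (0 : ℝ) M ×ˢ Icc (0 : ℝ) M, ENNReal.ofReal (h p.1 p.2) *
        ENNReal.ofReal (ratio (G p.2 - G p.1) (F p.2 - F p.1))) ≤ ENNReal.ofReal m := by
  -- If the total mass is zero, the quotients carry no information, but the densities vanish almost
  -- everywhere and so does the left side.
  rcases le_or_gt m 0 with h0 | h0
  · rw [ENNReal.ofReal_of_nonpos h0] at hf ⊢
    simp only [add_eq_zero] at hf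
    obtain ⟨⟨z₁, z₂⟩, z₃⟩ := hf
    have key : ∀ {S : Type} [MeasurableSpace S] {μ : Measure S} {f : S → ℝ} (k : S → ℝ≥0∞),
        AEMeasurable f μ → ∫⁻ s, ENNReal.ofReal (f s) ∂μ = 0 →
        ∫⁻ s, ENNReal.ofReal (f s) * k s ∂μ = 0 := by
      intro S _ μ f k hfm hf0
      rw [lintegral_eq_zero_iff' hfm.ennreal_ofReal] at hf0
      rw [lintegral_congr_ae (g := fun _ => 0), lintegral_zero]
      filter_upwards [hf0] with s hs
      rw [hs]; simp
    rw [key _ hm₁ z₁, key _ hm₂ z₂, key (f := fun p : ℝ × ℝ => h p.1 p.2) _ hm z₃]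
    simp
  · have hc0 : (ENNReal.ofReal m)⁻¹ ≠ 0 := ENNReal.inv_ne_zero.2 ENNReal.ofReal_ne_top
    have hct : (ENNReal.ofReal m)⁻¹ ≠ ⊤ := ENNReal.inv_ne_top.2 (by simpa using h0)
    have hdiv : ∀ y : ℝ, ENNReal.ofReal (y / m) = (ENNReal.ofReal m)⁻¹ * ENNReal.ofReal y :=
      fun y => by rw [ENNReal.ofReal_div_of_pos h0, ENNReal.div_eq_inv_mul]
    have hfin : ∀ z : ℝ≥0∞, z ≤ ENNReal.ofReal m → (ENNReal.ofReal m)⁻¹ * z ≠ ⊤ := fun z hz =>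
      ENNReal.mul_ne_top hct (hz.trans_lt ENNReal.ofReal_lt_top).ne
    have main := hF.lintegral_ratio_le hG hM hη (hm₁.div_const m) (hm₂.div_const m)
      (hm.div_const m) (by
        simp only [hdiv]; rw [lintegral_const_mul' _ _ hct]
        exact hfin _ (hf ▸ le_self_add.trans le_self_add)) (by
        simp only [hdiv]; rw [lintegral_const_mul' _ _ hct]
        exact hfin _ (hf ▸ le_add_self.trans le_self_add)) (by
        simp only [hdiv]; rw [lintegral_const_mul' _ _ hct]
        exact hfin _ (hf ▸ le_add_self))
      (fun r hr s hs hrs => hsep r hr s hs (by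
        rcases div_pos_iff.1 hrs with h | h
        · exact h.1
        · linarith [h.2]))
    simp only [hdiv, mul_assoc] at main
    simp only [lintegral_const_mul' _ _ hct, ← mul_add, hf] at main
    exact (ENNReal.mul_le_mul_iff_right hc0 hct).1 main

end Likelihood


section Indicators

lemma Δ₁_nonneg (x t : ℝ) : 0 ≤ Δ₁ x t := by unfold Δ₁; split_ifs <;> norm_num

lemma Δ₂_nonneg (x t u : ℝ) : 0 ≤ Δ₂ x t u := by unfold Δ₂; split_ifs <;> norm_num

lemma Δ₃_nonneg (x t u : ℝ) : 0 ≤ Δ₃ x t u := by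
  unfold Δ₃ Δ₁ Δ₂
  split_ifs with h1 h2
  · linarith [h2.1]
  all_goals norm_num

lemma Δ_add (x t u : ℝ) : Δ₁ x t + Δ₃ x t u + Δ₂ x t u = 1 := by unfold Δ₃; ring

end Indicators

/-! ### Lower bounds that are constant on grid cells -/

section Cells

/-- The value of `f` at the grid cell of `(t, u)` if both coordinates have distance at least `2δ`
to the end points of `[0, M]`, and `0` otherwise. -/
noncomputable def cellwise (δ M : ℝ) (f : ℕ → ℕ → ℝ) (t u : ℝ) : ℝ :=
  if t ∈ Icc (2 * δ) (M - 2 * δ) ∧ u ∈ Icc (2 * δ) (M - 2 * δ) then f ⌊t / δ⌋₊ ⌊u / δ⌋₊ else 0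

variable {δ M : ℝ} {G F : ℝ → ℝ}

lemma floor_mul_le (hδ : 0 < δ) {x : ℝ} (hx : 0 ≤ x) : ⌊x / δ⌋₊ * δ ≤ x :=
  (le_div_iff₀ hδ).1 (Nat.floor_le (div_nonneg hx hδ.le))

lemma lt_floor_add_one_mul (hδ : 0 < δ) (x : ℝ) : x < (⌊x / δ⌋₊ + 1) * δ :=
  (div_lt_iff₀ hδ).1 (Nat.lt_floor_add_one _)

/-- The indicator of a grid cell. -/
noncomputable def atom (δ M : ℝ) (j k : ℕ) (t u : ℝ) : ℝ :=
  cellwise δ M (fun j' k' => if j' = j ∧ k' = k then 1 else 0) t u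

/-- Coefficients that depend on the estimate, hence on the whole sample, separate from finitely many
fixed indicators. The strong law is needed only for the latter. -/
lemma cellwise_eq_sum (hδ : 0 < δ) (f : ℕ → ℕ → ℝ) (t u : ℝ) :
    cellwise δ M f t u = ∑ j ∈ Finset.range (⌊M / δ⌋₊ + 1), ∑ k ∈ Finset.range (⌊M / δ⌋₊ + 1),
      atom δ M j k t u * f j k := by
  unfold atom cellwise
  split_ifs with h
  · have hlt : ∀ x ∈ Icc (2 * δ) (M - 2 * δ), ⌊x / δ⌋₊ ∈ Finset.range (⌊M / δ⌋₊ + 1) :=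
      fun x hx => Finset.mem_range.2 (Nat.lt_succ_of_le (Nat.floor_le_floor (by
        gcongr; linarith [hx.2])))
    rw [Finset.sum_eq_single_of_mem _ (hlt t h.1), Finset.sum_eq_single_of_mem _ (hlt u h.2)]
    · simp
    · intro k _ hk
      simp [hk.symm]
    · intro j _ hj
      exact Finset.sum_eq_zero fun k _ => by simp [hj.symm]
  · simp

@[fun_prop]
lemma measurable_cellwise (δ M : ℝ) (f : ℕ → ℕ → ℝ) :
    Measurable fun p : ℝ × ℝ => cellwise δ M f p.1 p.2 := by
  unfold cellwise
  refine Measurable.ite ?_ ?_ measurable_const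
  · exact measurableSet_Icc.prod measurableSet_Icc
  · exact (measurable_of_countable fun q : ℕ × ℕ => f q.1 q.2).comp
      ((Nat.measurable_floor.comp (measurable_fst.div_const δ)).prodMk
        (Nat.measurable_floor.comp (measurable_snd.div_const δ)))

lemma cellwise_mem_Icc {f : ℕ → ℕ → ℝ} {c : ℝ} (hc : 0 ≤ c) {t u : ℝ}
    (hf : f ⌊t / δ⌋₊ ⌊u / δ⌋₊ ∈ Icc 0 c) : cellwise δ M f t u ∈ Icc 0 c := by
  unfold cellwise
  split_ifs
  · exact hf
  · exact ⟨le_rfl, hc⟩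

/-- The value at the cell `j` of a lower bound for `ratio G F`. -/
noncomputable def coeff₁ (δ : ℝ) (G F : ℝ → ℝ) (j _k : ℕ) : ℝ :=
  ratio (G ((j - 1) * δ)) (F ((j + 2) * δ))

/-- The value at the cell `k` of a lower bound for `ratio (1 - G) (1 - F)`. -/
noncomputable def coeff₃ (δ : ℝ) (G F : ℝ → ℝ) (_j k : ℕ) : ℝ :=
  ratio (1 - G ((k + 2) * δ)) (1 - F ((k - 1) * δ))

/-- The value at the cell `(j, k)` of a lower bound for `ratio (G u - G t) (F u - F t)`. -/
noncomputable def coeff₂ (δ : ℝ) (G F : ℝ → ℝ) (j k : ℕ) : ℝ :=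
  ratio (max 0 (G ((k - 1) * δ) - G ((j + 2) * δ))) (max 0 (F ((k + 2) * δ) - F ((j - 1) * δ)))

lemma coeff₁_mem (hG : ∀ x, G x ∈ Icc (0 : ℝ) 1) (hF : ∀ x, F x ∈ Icc (0 : ℝ) 1) (j k : ℕ) :
    coeff₁ δ G F j k ∈ Icc (0 : ℝ) 2 :=
  ⟨ratio_nonneg (hG _).1 (hF _).1, ratio_le_two (hG _).1 (hF _).1⟩

lemma coeff₃_mem (hG : ∀ x, G x ∈ Icc (0 : ℝ) 1) (hF : ∀ x, F x ∈ Icc (0 : ℝ) 1) (j k : ℕ) :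
    coeff₃ δ G F j k ∈ Icc (0 : ℝ) 2 :=
  ⟨ratio_nonneg (sub_nonneg.2 (hG _).2) (sub_nonneg.2 (hF _).2),
    ratio_le_two (sub_nonneg.2 (hG _).2) (sub_nonneg.2 (hF _).2)⟩

lemma coeff₂_mem (j k : ℕ) : coeff₂ δ G F j k ∈ Icc (0 : ℝ) 2 :=
  ⟨ratio_nonneg (le_max_left _ _) (le_max_left _ _),
    ratio_le_two (le_max_left _ _) (le_max_left _ _)⟩

/-- A cell of width `δ` enlarged by `δ` on both sides gives the offsets `-1` and `+2` in the
coefficients. -/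
lemma grid_le (hδ : 0 < δ) {x s : ℝ} (hx : 0 ≤ x) (hs : |s - x| ≤ δ) :
    (⌊x / δ⌋₊ - 1) * δ ≤ s ∧ s ≤ (⌊x / δ⌋₊ + 2) * δ := by
  have h1 := floor_mul_le hδ hx
  have h2 := lt_floor_add_one_mul hδ x
  have h3 := abs_le.1 hs
  constructor <;> nlinarith

lemma coeff₁_le (hδ : 0 < δ) (hGm : Monotone G) (hFm : Monotone F)
    (hG : ∀ x, G x ∈ Icc (0 : ℝ) 1) (hF : ∀ x, F x ∈ Icc (0 : ℝ) 1) {x s : ℝ} (hx : 0 ≤ x)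
    (hs : |s - x| ≤ δ) (k : ℕ) : coeff₁ δ G F ⌊x / δ⌋₊ k ≤ ratio (G s) (F s) :=
  ratio_mono (hG _).1 (hGm (grid_le hδ hx hs).1) (hF _).1 (hFm (grid_le hδ hx hs).2)

lemma coeff₃_le (hδ : 0 < δ) (hGm : Monotone G) (hFm : Monotone F)
    (hG : ∀ x, G x ∈ Icc (0 : ℝ) 1) (hF : ∀ x, F x ∈ Icc (0 : ℝ) 1) {x s : ℝ} (hx : 0 ≤ x)
    (hs : |s - x| ≤ δ) (j : ℕ) : coeff₃ δ G F j ⌊x / δ⌋₊ ≤ ratio (1 - G s) (1 - F s) :=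
  ratio_mono (sub_nonneg.2 (hG _).2) (sub_le_sub_left (hGm (grid_le hδ hx hs).2) _)
    (sub_nonneg.2 (hF _).2) (sub_le_sub_left (hFm (grid_le hδ hx hs).1) _)

/-- An increment is bounded below by moving its end points inwards and above by moving them
outwards. The truncation at 0 in `coeff₂` is harmless, as the true increments are nonnegative for `r
≤ s`. -/
lemma coeff₂_le (hδ : 0 < δ) (hGm : Monotone G) (hFm : Monotone F) {x y r s : ℝ} (hx : 0 ≤ x)
    (hy : 0 ≤ y) (hr : |r - x| ≤ δ) (hs : |s - y| ≤ δ) (hrs : r ≤ s) :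
    coeff₂ δ G F ⌊x / δ⌋₊ ⌊y / δ⌋₊ ≤ ratio (G s - G r) (F s - F r) :=
  ratio_mono (le_max_left _ _)
    (max_le (sub_nonneg.2 (hGm hrs))
      (sub_le_sub (hGm (grid_le hδ hy hs).1) (hGm (grid_le hδ hx hr).2)))
    (sub_nonneg.2 (hFm hrs))
    ((sub_le_sub (hFm (grid_le hδ hy hs).2) (hFm (grid_le hδ hx hr).1)).trans (le_max_right _ _))

lemma cellwise_ne_zero {f : ℕ → ℕ → ℝ} {t u : ℝ} (h : cellwise δ M f t u ≠ 0) :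
    t ∈ Icc (2 * δ) (M - 2 * δ) ∧ u ∈ Icc (2 * δ) (M - 2 * δ) ∧
      cellwise δ M f t u = f ⌊t / δ⌋₊ ⌊u / δ⌋₊ := by
  by_cases hg : t ∈ Icc (2 * δ) (M - 2 * δ) ∧ u ∈ Icc (2 * δ) (M - 2 * δ)
  · exact ⟨hg.1, hg.2, if_pos hg⟩
  · exact absurd (if_neg hg) h

/-- A lower bound for the likelihood ratio of `G` with respect to the midpoint of `F` and `G`, at
the observation `(x, t, u)`. -/
noncomputable def lowerRatio (δ M : ℝ) (G F : ℝ → ℝ) (x t u : ℝ) : ℝ :=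
  Δ₁ x t * cellwise δ M (coeff₁ δ G F) t u + Δ₃ x t u * cellwise δ M (coeff₃ δ G F) t u +
    Δ₂ x t u * cellwise δ M (coeff₂ δ G F) t u

end Cells

/-! ### The empirical inequality for an estimate -/

section Empirical

variable {K α β : ℝ → ℝ} {M b δ ε C : ℝ} {n : ℕ} {x t u : ℕ → ℝ} {G F : ℝ → ℝ}

lemma ne_zero_of_weight_ne_zero (hK : IsKernel K)
    (hC : ∀ u ∈ Icc (0 : ℝ) 1, |α u| ≤ C ∧ |β u| ≤ C) (hb : 0 < b) {s : ℝ} (hs : s ∈ Icc 0 M)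
    {y : ℝ} (h : weight K α β M b s y ≠ 0) : |s - y| ≤ b := by
  refine abs_sub_le_of_scaled_ne_zero hK hb fun h0 => h ?_
  have := abs_weight_le hK hC hb le_rfl hs y
  rw [h0, mul_zero] at this
  exact abs_nonpos_iff.1 this

/-- Smoothing moves each coordinate by at most `b`, so the smoothed density still vanishes near the
diagonal. This keeps the likelihood of the linear competitor finite. -/
lemma sub_le_of_smooth₂_pos (hK : IsKernel K)
    (hC : ∀ u ∈ Icc (0 : ℝ) 1, |α u| ≤ C ∧ |β u| ≤ C) (hb : 0 < b) (hε : ∀ i, ε ≤ u i - t i)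
    {d : ℕ → ℝ} {p : ℝ × ℝ} (hp : p ∈ Icc (0 : ℝ) M ×ˢ Icc (0 : ℝ) M)
    (h : 0 < smooth₂ (weight K α β M b) n d t u p) : ε - 2 * b ≤ p.2 - p.1 := by
  obtain ⟨i, -, hi⟩ : ∃ i ∈ Finset.range n,
      weight K α β M b p.1 (t i) * weight K α β M b p.2 (u i) * d i ≠ 0 := by
    by_contra! hall
    simp [smooth₂, Finset.sum_eq_zero hall] at h
  have hw := left_ne_zero_of_mul hi
  have h1 := abs_le.1 (ne_zero_of_weight_ne_zero hK hC hb hp.1 (left_ne_zero_of_mul hw))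
  have h2 := abs_le.1 (ne_zero_of_weight_ne_zero hK hC hb hp.2 (right_ne_zero_of_mul hw))
  linarith [hε i]

lemma lintegral_add_eq_totalMass (hK : IsKernel K) (hα : ContinuousOn α (Icc 0 1))
    (hβ : ContinuousOn β (Icc 0 1)) (hC : ∀ u ∈ Icc (0 : ℝ) 1, |α u| ≤ C ∧ |β u| ≤ C)
    (hb : 0 < b) :
    (∫⁻ s in Icc 0 M, ENNReal.ofReal (raw₁ (weight K α β M b) n x t s)) +
      (∫⁻ s in Icc 0 M, ENNReal.ofReal (raw₂ (weight K α β M b) n x t u s)) +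
      (∫⁻ p in Icc (0 : ℝ) M ×ˢ Icc (0 : ℝ) M,
        ENNReal.ofReal (raw (weight K α β M b) n x t u p.1 p.2)) =
      ENNReal.ofReal (totalMass (weight K α β M b) M n x t u) := by
  have n₁ : ∀ s, 0 ≤ raw₁ (weight K α β M b) n x t s := fun s => le_max_left _ _
  have n₂ : ∀ s, 0 ≤ raw₂ (weight K α β M b) n x t u s := fun s => le_max_left _ _
  have n₃ : ∀ r s, 0 ≤ raw (weight K α β M b) n x t u r s := fun r s => le_max_left _ _
  have i₁ : Integrable (raw₁ (weight K α β M b) n x t) (volume.restrict (Icc 0 M)) :=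
    ⟨(aemeasurable_smooth (d := fun i => Δ₁ (x i) (t i)) hK hα hβ hb).aestronglyMeasurable, by
      rw [hasFiniteIntegral_iff_ofReal (ae_of_all _ n₁)]
      exact (lintegral_smooth_le hK hC hb le_rfl fun i => Δ₁_nonneg _ _).trans_lt
        ENNReal.ofReal_lt_top⟩
  have i₂ : Integrable (raw₂ (weight K α β M b) n x t u) (volume.restrict (Icc 0 M)) :=
    ⟨(aemeasurable_smooth (d := fun i => Δ₃ (x i) (t i) (u i)) hK hα hβ hb).aestronglyMeasurable,
      by
      rw [hasFiniteIntegral_iff_ofReal (ae_of_all _ n₂)]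
      exact (lintegral_smooth_le hK hC hb le_rfl fun i => Δ₃_nonneg _ _ _).trans_lt
        ENNReal.ofReal_lt_top⟩
  have i₃ : Integrable (fun p : ℝ × ℝ => raw (weight K α β M b) n x t u p.1 p.2)
      (volume.restrict (Icc (0 : ℝ) M ×ˢ Icc (0 : ℝ) M)) :=
    ⟨(aemeasurable_smooth₂ (d := fun i => Δ₂ (x i) (t i) (u i)) hK hα hβ hb).aestronglyMeasurable,
      by
      rw [hasFiniteIntegral_iff_ofReal (ae_of_all _ fun _ => n₃ _ _)]
      exact (lintegral_smooth₂_le hK hC hb le_rfl fun i => Δ₂_nonneg _ _ _).trans_lt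
        ENNReal.ofReal_lt_top⟩
  rw [totalMass, integral_add i₁ i₂, ENNReal.ofReal_add
      (add_nonneg (integral_nonneg n₁) (integral_nonneg n₂)) (integral_nonneg fun p => n₃ _ _),
    ENNReal.ofReal_add (integral_nonneg n₁) (integral_nonneg n₂),
    ofReal_integral_eq_lintegral_ofReal i₁ (ae_of_all _ n₁),
    ofReal_integral_eq_lintegral_ofReal i₂ (ae_of_all _ n₂),
    ofReal_integral_eq_lintegral_ofReal i₃ (ae_of_all _ fun p => n₃ _ _)]

/-- The empirical inequality satisfied by a maximum smoothed likelihood estimate. -/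
lemma IsMSLE.average_lowerRatio_le (hK : IsKernel K) (hα : ContinuousOn α (Icc 0 1))
    (hβ : ContinuousOn β (Icc 0 1)) (hC : ∀ u ∈ Icc (0 : ℝ) 1, |α u| ≤ C ∧ |β u| ≤ C)
    (hb : 0 < b) (hbδ : b ≤ δ) (hbε : 2 * b < ε) (hM : 0 < M) (hε : ∀ i, ε ≤ u i - t i)
    (hF : IsMSLE K α β M b n x t u F) (hFm : Monotone F) (hF1 : ∀ s, F s ∈ Icc (0 : ℝ) 1)
    (hG : IsDistFun M G) (hGm : Monotone G) (hG1 : ∀ s, G s ∈ Icc (0 : ℝ) 1) :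
    (1 / (n : ℝ)) * ∑ i ∈ Finset.range n, lowerRatio δ M G F (x i) (t i) (u i) ≤
      (1 / (n : ℝ)) * ∑ i ∈ Finset.range n, edgeFactor C δ M (t i) * edgeFactor C δ M (u i) := by
  have hδ : 0 < δ := hb.trans_le hbδ
  have hC0 : 0 ≤ C := (abs_nonneg _).trans (hC 0 (by simp)).1
  have hρ : ∀ y, 1 ≤ edgeFactor C δ M y := one_le_edgeFactor hC0 δ M
  have hmass := lintegral_add_eq_totalMass (M := M) (n := n) (x := x) (t := t) (u := u) hK hα hβ hC hb
  have main := IsMaximizer.lintegral_ratio_le_of_div hF hG hM (sub_pos.2 hbε)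
    (aemeasurable_smooth (d := fun i => Δ₁ (x i) (t i)) hK hα hβ hb)
    (aemeasurable_smooth (d := fun i => Δ₃ (x i) (t i) (u i)) hK hα hβ hb)
    (aemeasurable_smooth₂ (d := fun i => Δ₂ (x i) (t i) (u i)) hK hα hβ hb)
    hmass
    (fun r hr s hs h => sub_le_of_smooth₂_pos (d := fun i => Δ₂ (x i) (t i) (u i)) hK hC hb hε
      (p := (r, s)) ⟨hr, hs⟩ h)
  rw [← hmass] at main
  have m₁ := fun i => (cellwise_mem_Icc (M := M) zero_le_two
    (coeff₁_mem (δ := δ) hG1 hF1 ⌊t i / δ⌋₊ ⌊u i / δ⌋₊)).1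
  have m₂ := fun i => (cellwise_mem_Icc (M := M) zero_le_two
    (coeff₂_mem (δ := δ) (G := G) (F := F) ⌊t i / δ⌋₊ ⌊u i / δ⌋₊)).1
  have m₃ := fun i => (cellwise_mem_Icc (M := M) zero_le_two
    (coeff₃_mem (δ := δ) hG1 hF1 ⌊t i / δ⌋₊ ⌊u i / δ⌋₊)).1
  have l₁ := le_lintegral_smooth_mul (M := M) (n := n) (t := t) (α := α) (β := β) hK hb hbδ
    (φ := fun s => ratio (G s) (F s))
    (d := fun i => Δ₁ (x i) (t i))
    (e := fun i => Δ₁ (x i) (t i) * cellwise δ M (coeff₁ δ G F) (t i) (u i))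
    (fun i => Δ₁_nonneg _ _) (fun i => mul_nonneg (Δ₁_nonneg _ _) (m₁ i))
    (fun s _ => ratio_nonneg (hG1 s).1 (hF1 s).1) (fun i hi => by
      obtain ⟨h1, h2, h3⟩ := cellwise_ne_zero (right_ne_zero_of_mul hi)
      refine ⟨h1, fun s _ hs => ?_⟩
      rw [h3]
      exact mul_le_mul_of_nonneg_left (coeff₁_le hδ hGm hFm hG1 hF1 (by linarith [h1.1])
        (hs.trans hbδ) _) (Δ₁_nonneg _ _))
  have l₃ := le_lintegral_smooth_mul (M := M) (n := n) (t := u) (α := α) (β := β) hK hb hbδ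
    (φ := fun s => ratio (1 - G s) (1 - F s))
    (d := fun i => Δ₃ (x i) (t i) (u i))
    (e := fun i => Δ₃ (x i) (t i) (u i) * cellwise δ M (coeff₃ δ G F) (t i) (u i))
    (fun i => Δ₃_nonneg _ _ _) (fun i => mul_nonneg (Δ₃_nonneg _ _ _) (m₃ i))
    (fun s _ => ratio_nonneg (sub_nonneg.2 (hG1 s).2) (sub_nonneg.2 (hF1 s).2)) (fun i hi => by
      obtain ⟨h1, h2, h3⟩ := cellwise_ne_zero (right_ne_zero_of_mul hi)
      refine ⟨h2, fun s _ hs => ?_⟩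
      rw [h3]
      exact mul_le_mul_of_nonneg_left (coeff₃_le hδ hGm hFm hG1 hF1 (by linarith [h2.1])
        (hs.trans hbδ) _) (Δ₃_nonneg _ _ _))
  -- The windows around `t i` and `u i` do not overlap, since `2 * b < ε`.
  have hord : ∀ i r s, |r - t i| ≤ b → |s - u i| ≤ b → r ≤ s := fun i r s hr hs => by
    linarith [abs_le.1 hr, abs_le.1 hs, (abs_le.1 hr).2, (abs_le.1 hs).1, hε i]
  have l₂ := le_lintegral_smooth₂_mul (M := M) (n := n) (t := t) (u := u) (α := α) (β := β)
    hK hb hbδ (φ := fun p => ratio (G p.2 - G p.1) (F p.2 - F p.1))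
    (d := fun i => Δ₂ (x i) (t i) (u i))
    (e := fun i => Δ₂ (x i) (t i) (u i) * cellwise δ M (coeff₂ δ G F) (t i) (u i))
    (fun i => Δ₂_nonneg _ _ _) (fun i => mul_nonneg (Δ₂_nonneg _ _ _) (m₂ i))
    (fun i hi => by
      obtain ⟨h1, h2, h3⟩ := cellwise_ne_zero (right_ne_zero_of_mul hi)
      refine ⟨h1, h2, fun r _ s _ hr hs => ?_⟩
      rw [h3]
      exact mul_le_mul_of_nonneg_left (coeff₂_le hδ hGm hFm (by linarith [h1.1])
        (by linarith [h2.1]) (hr.trans hbδ) (hs.trans hbδ) (hord i r s hr hs)) (Δ₂_nonneg _ _ _))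
    (fun i _ r _ s _ hr hs => ratio_nonneg (sub_nonneg.2 (hGm (hord i r s hr hs)))
      (sub_nonneg.2 (hFm (hord i r s hr hs))))
  have u₁ := lintegral_smooth_le (M := M) (n := n) (t := t) (d := fun i => Δ₁ (x i) (t i))
    hK hC hb hbδ (fun i => Δ₁_nonneg _ _)
  have u₃ := lintegral_smooth_le (M := M) (n := n) (t := u) (d := fun i => Δ₃ (x i) (t i) (u i))
    hK hC hb hbδ (fun i => Δ₃_nonneg _ _ _)
  have u₂ := lintegral_smooth₂_le (M := M) (n := n) (t := t) (u := u)
    (d := fun i => Δ₂ (x i) (t i) (u i)) hK hC hb hbδ (fun i => Δ₂_nonneg _ _ _)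
  have hall := (add_le_add (add_le_add l₁ l₃) l₂).trans
    (main.trans (add_le_add (add_le_add u₁ u₃) u₂))
  have hpos : ∀ f : ℕ → ℝ, (∀ i, 0 ≤ f i) → 0 ≤ (1 / (n : ℝ)) * ∑ i ∈ Finset.range n, f i :=
    fun f hf => mul_nonneg (by positivity) (Finset.sum_nonneg fun i _ => hf i)
  have hρ0 : ∀ y, 0 ≤ edgeFactor C δ M y := fun y => zero_le_one.trans (hρ y)
  have p₁ := hpos _ fun i => mul_nonneg (Δ₁_nonneg (x i) (t i)) (m₁ i)
  have p₃ := hpos _ fun i => mul_nonneg (Δ₃_nonneg (x i) (t i) (u i)) (m₃ i)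
  have p₂ := hpos _ fun i => mul_nonneg (Δ₂_nonneg (x i) (t i) (u i)) (m₂ i)
  have q₁ := hpos _ fun i => mul_nonneg (hρ0 (t i)) (Δ₁_nonneg (x i) (t i))
  have q₃ := hpos _ fun i => mul_nonneg (hρ0 (u i)) (Δ₃_nonneg (x i) (t i) (u i))
  have q₂ := hpos _ fun i => mul_nonneg (mul_nonneg (hρ0 (t i)) (hρ0 (u i)))
    (Δ₂_nonneg (x i) (t i) (u i))
  rw [← ENNReal.ofReal_add p₁ p₃, ← ENNReal.ofReal_add (add_nonneg p₁ p₃) p₂,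
    ← ENNReal.ofReal_add q₁ q₃, ← ENNReal.ofReal_add (add_nonneg q₁ q₃) q₂,
    ENNReal.ofReal_le_ofReal_iff (add_nonneg (add_nonneg q₁ q₃) q₂),
    ← mul_add, ← mul_add, ← mul_add, ← mul_add, ← Finset.sum_add_distrib,
    ← Finset.sum_add_distrib, ← Finset.sum_add_distrib, ← Finset.sum_add_distrib] at hall
  -- As edge factors are at least 1, each single factor may be replaced by the product of both; then
  -- the three indicators sum to 1.
  refine hall.trans (mul_le_mul_of_nonneg_left (Finset.sum_le_sum fun i _ => ?_) (by positivity))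
  have d₁ := Δ₁_nonneg (x i) (t i)
  have d₂ := Δ₂_nonneg (x i) (t i) (u i)
  have d₃ := Δ₃_nonneg (x i) (t i) (u i)
  have a₁ : edgeFactor C δ M (t i) ≤ edgeFactor C δ M (t i) * edgeFactor C δ M (u i) :=
    le_mul_of_one_le_right (hρ0 _) (hρ _)
  have a₃ : edgeFactor C δ M (u i) ≤ edgeFactor C δ M (t i) * edgeFactor C δ M (u i) :=
    le_mul_of_one_le_left (hρ0 _) (hρ _)
  calc _ ≤ edgeFactor C δ M (t i) * edgeFactor C δ M (u i) * Δ₁ (x i) (t i) +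
        edgeFactor C δ M (t i) * edgeFactor C δ M (u i) * Δ₃ (x i) (t i) (u i) +
        edgeFactor C δ M (t i) * edgeFactor C δ M (u i) * Δ₂ (x i) (t i) (u i) := by gcongr
    _ = _ := by rw [← mul_add, ← mul_add, Δ_add, mul_one]

end Empirical


/-! ### Law of large numbers and the hidden variable -/

section Sample

variable {Ω : Type*} [MeasurableSpace Ω] {P : Measure Ω}
  {X T U : ℕ → Ω → ℝ} {ν : Measure ℝ} {g : ℝ → ℝ → ℝ}

lemma IsSample.isProbabilityMeasure_obsLaw [IsProbabilityMeasure P] (hs : IsSample P X T U ν g) :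
    IsProbabilityMeasure (obsLaw g) := by
  rw [← hs.law_TU 0]
  exact Measure.isProbabilityMeasure_map
    ((hs.measurable_T 0).prodMk (hs.measurable_U 0)).aemeasurable

lemma IsSample.measurable_triple (hs : IsSample P X T U ν g) (i : ℕ) :
    Measurable fun ω => (X i ω, T i ω, U i ω) :=
  (hs.measurable_X i).prodMk ((hs.measurable_T i).prodMk (hs.measurable_U i))

lemma IsSample.map_triple [IsProbabilityMeasure P] (hs : IsSample P X T U ν g) (i : ℕ) :
    P.map (fun ω => (X i ω, T i ω, U i ω)) = ν.prod (obsLaw g) := by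
  rw [← hs.law_X i, ← hs.law_TU i]
  exact (indepFun_iff_map_prod_eq_prod_map_map (hs.measurable_X i).aemeasurable
    ((hs.measurable_T i).prodMk (hs.measurable_U i)).aemeasurable).1 (hs.indep_hidden i)

/-- The strong law of large numbers for bounded functions of the sample. -/
lemma IsSample.ae_tendsto_average [IsProbabilityMeasure P] (hs : IsSample P X T U ν g) {f : ℝ × ℝ × ℝ → ℝ}
    (hf : Measurable f) {c : ℝ} (hc : ∀ z, |f z| ≤ c) :
    ∀ᵐ ω ∂P, Tendsto
      (fun n : ℕ => (1 / (n : ℝ)) * ∑ i ∈ Finset.range n, f (X i ω, T i ω, U i ω)) atTop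
      (𝓝 (∫ z, f z ∂ν.prod (obsLaw g))) := by
  have hint : Integrable (fun ω => f (X 0 ω, T 0 ω, U 0 ω)) P :=
    Integrable.of_bound (hf.comp (hs.measurable_triple 0)).aestronglyMeasurable c
      (ae_of_all _ fun ω => hc _)
  have hident : ∀ i, IdentDistrib (fun ω => f (X i ω, T i ω, U i ω))
      (fun ω => f (X 0 ω, T 0 ω, U 0 ω)) P P := fun i =>
    IdentDistrib.comp (f := fun ω => (X i ω, T i ω, U i ω)) (g := fun ω => (X 0 ω, T 0 ω, U 0 ω))
      ⟨(hs.measurable_triple i).aemeasurable, (hs.measurable_triple 0).aemeasurable, by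
        rw [hs.map_triple, hs.map_triple]⟩ hf
  have hindep := hs.indep_triples.comp (fun _ => f) fun _ => hf
  have h := strong_law_ae_real (fun i ω => f (X i ω, T i ω, U i ω)) hint
    (fun i j hij => hindep.indepFun hij) hident
  rw [← hs.map_triple 0, integral_map (hs.measurable_triple 0).aemeasurable
    hf.aestronglyMeasurable]
  filter_upwards [h] with ω hω
  refine hω.congr fun n => ?_
  rw [one_div, div_eq_inv_mul]

end Sample

section Hidden

variable {ν : Measure ℝ} [IsProbabilityMeasure ν] {μ : Measure (ℝ × ℝ)} [IsProbabilityMeasure μ]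

/-- Integrating out the hidden variable. -/
lemma integral_hidden {D : ℝ → ℝ × ℝ → ℝ} {q h : ℝ × ℝ → ℝ} {c : ℝ}
    (hD : Measurable fun z : ℝ × ℝ × ℝ => D z.1 z.2) (hD0 : ∀ x p, |D x p| ≤ 1)
    (hh : Measurable h) (hc : ∀ p, |h p| ≤ c) (hq : ∀ᵐ p ∂μ, ∫ x, D x p ∂ν = q p) :
    ∫ z, D z.1 z.2 * h z.2 ∂ν.prod μ = ∫ p, q p * h p ∂μ := by
  rw [integral_prod_symm (fun z : ℝ × ℝ × ℝ => D z.1 z.2 * h z.2)]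
  · refine integral_congr_ae ?_
    filter_upwards [hq] with p hp
    simp only [integral_mul_const, hp]
  · refine Integrable.of_bound (hD.mul (hh.comp measurable_snd)).aestronglyMeasurable (1 * c)
      (ae_of_all _ fun z => ?_)
    rw [Real.norm_eq_abs, abs_mul]
    exact mul_le_mul (hD0 _ _) (hc _) (abs_nonneg _) zero_le_one

lemma measurable_Δ₁ : Measurable fun z : ℝ × ℝ × ℝ => Δ₁ z.1 z.2.1 :=
  Measurable.ite (measurableSet_le measurable_fst measurable_snd.fst) measurable_const
    measurable_const

lemma measurable_Δ₂ : Measurable fun z : ℝ × ℝ × ℝ => Δ₂ z.1 z.2.1 z.2.2 :=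
  Measurable.ite ((measurableSet_lt measurable_snd.fst measurable_fst).inter
    (measurableSet_le measurable_fst measurable_snd.snd)) measurable_const measurable_const

lemma measurable_Δ₃ : Measurable fun z : ℝ × ℝ × ℝ => Δ₃ z.1 z.2.1 z.2.2 :=
  (measurable_const.sub measurable_Δ₁).sub measurable_Δ₂

lemma abs_Δ₁_le (x t : ℝ) : |Δ₁ x t| ≤ 1 := by unfold Δ₁; split_ifs <;> norm_num

lemma abs_Δ₂_le (x t u : ℝ) : |Δ₂ x t u| ≤ 1 := by unfold Δ₂; split_ifs <;> norm_num

lemma abs_Δ₃_le (x t u : ℝ) : |Δ₃ x t u| ≤ 1 := by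
  rw [abs_of_nonneg (Δ₃_nonneg _ _ _)]
  linarith [Δ_add x t u, Δ₁_nonneg x t, Δ₂_nonneg x t u]

lemma integral_Δ₁ (t : ℝ) : ∫ x, Δ₁ x t ∂ν = cdf ν t := by
  have : (fun x => Δ₁ x t) = (Iic t).indicator 1 := by
    ext x; simp [Δ₁, indicator]
  rw [this, integral_indicator_one measurableSet_Iic, cdf_eq_real]

lemma integral_Δ₂ {t u : ℝ} (h : t ≤ u) : ∫ x, Δ₂ x t u ∂ν = cdf ν u - cdf ν t := by
  have : (fun x => Δ₂ x t u) = (Ioc t u).indicator 1 := by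
    ext x; simp [Δ₂, indicator]
  have hd : Ioc t u = Iic u \ Iic t := by ext x; simp [and_comm]
  rw [this, integral_indicator_one measurableSet_Ioc, cdf_eq_real, cdf_eq_real, hd,
    measureReal_sdiff (Iic_subset_Iic.2 h) measurableSet_Iic]

lemma integral_Δ₃ {t u : ℝ} (h : t ≤ u) : ∫ x, Δ₃ x t u ∂ν = 1 - cdf ν u := by
  have i₁ : Integrable (fun x => Δ₁ x t) ν := Integrable.of_bound
    (measurable_Δ₁.comp (measurable_id.prodMk measurable_const :
      Measurable fun x : ℝ => (x, (t, u)))).aestronglyMeasurable 1 (ae_of_all _ fun x => abs_Δ₁_le x t)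
  have i₂ : Integrable (fun x => Δ₂ x t u) ν := Integrable.of_bound
    (measurable_Δ₂.comp (measurable_id.prodMk measurable_const :
      Measurable fun x : ℝ => (x, (t, u)))).aestronglyMeasurable 1
      (ae_of_all _ fun x => abs_Δ₂_le x t u)
  have i₀ : Integrable (fun x => 1 - Δ₁ x t) ν := (integrable_const _).sub i₁
  unfold Δ₃
  rw [integral_sub i₀ i₂, integral_sub (integrable_const _) i₁, integral_Δ₁, integral_Δ₂ h]
  simp

end Hidden

/-! ### Almost sure properties of the observation points -/

section ObservationLaw

variable {g : ℝ → ℝ → ℝ} {M ε : ℝ} {ν : Measure ℝ}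

lemma SeparatedCase.M_pos (h : SeparatedCase M ε ν g) : 0 < M := by
  linarith [h.eps_pos, h.eps_le]

lemma SeparatedCase.ae_obsLaw_iff (h : SeparatedCase M ε ν g) {p : ℝ × ℝ → Prop} :
    (∀ᵐ z ∂obsLaw g, p z) ↔ ∀ᵐ z : ℝ × ℝ, g z.1 z.2 ≠ 0 → p z := by
  unfold obsLaw
  rw [ae_withDensity_iff h.g_measurable.ennreal_ofReal]
  refine eventually_congr (ae_of_all _ fun z => ?_)
  rw [ENNReal.ofReal_ne_zero_iff, (h.g_nonneg _ _).lt_iff_ne']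

lemma SeparatedCase.ae_le_obsLaw (h : SeparatedCase M ε ν g) :
    ∀ᵐ z ∂obsLaw g, ε ≤ z.2 - z.1 := by
  rw [ae_iff]; simpa using h.separated

lemma SeparatedCase.ae_fst_of_ae (h : SeparatedCase M ε ν g) {p : ℝ → Prop}
    (hp : ∀ᵐ t : ℝ, p t) : ∀ᵐ z ∂obsLaw g, p z.1 := by
  rw [h.ae_obsLaw_iff, Measure.volume_eq_prod]
  filter_upwards [Measure.quasiMeasurePreserving_fst.ae hp] with z hz _ using hz

lemma SeparatedCase.ae_snd_of_ae (h : SeparatedCase M ε ν g) {p : ℝ → Prop}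
    (hp : ∀ᵐ t : ℝ, p t) : ∀ᵐ z ∂obsLaw g, p z.2 := by
  rw [h.ae_obsLaw_iff, Measure.volume_eq_prod]
  filter_upwards [Measure.quasiMeasurePreserving_snd.ae hp] with z hz _ using hz

lemma SeparatedCase.ae_mem_Ioo (h : SeparatedCase M ε ν g) :
    ∀ᵐ z ∂obsLaw g, z.1 ∈ Ioo 0 M ∧ z.2 ∈ Ioo 0 M := by
  have h0 : ∀ a : ℝ, ∀ᵐ t : ℝ, t ≠ a := fun a => by simp [ae_iff]
  have hg : ∀ᵐ z ∂obsLaw g, 0 ≤ z.1 ∧ z.1 < z.2 ∧ z.2 ≤ M := by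
    rw [h.ae_obsLaw_iff]
    exact ae_of_all _ fun z hz => by
      by_contra hc
      exact hz (h.g_zero_outside _ _ hc)
  filter_upwards [hg, h.ae_fst_of_ae (h0 0), h.ae_snd_of_ae (h0 M)] with z hz h1 h2
  have h3 := lt_of_le_of_ne hz.1 (Ne.symm h1)
  have h4 := lt_of_le_of_ne hz.2.2 h2
  exact ⟨⟨h3, hz.2.1.trans h4⟩, h3.trans hz.2.1, h4⟩

/-- A property of both coordinates that holds almost surely holds almost everywhere on `[0, M]`. -/
lemma SeparatedCase.ae_of_ae_obsLaw (h : SeparatedCase M ε ν g) {p : ℝ → Prop}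
    (hp : ∀ᵐ z ∂obsLaw g, p z.1 ∧ p z.2) : ∀ᵐ s : ℝ, s ∈ Icc 0 M → p s := by
  rw [h.ae_obsLaw_iff, Measure.volume_eq_prod] at hp
  have h1 := Measure.ae_ae_of_ae_prod hp
  have h2 := Measure.ae_ae_of_ae_prod
    ((Measure.measurePreserving_swap (μ := volume) (ν := volume)).quasiMeasurePreserving.ae hp)
  filter_upwards [h1, h2] with s hs1 hs2 hs
  by_contra hps
  -- If `p s` fails, both sections of `g` through `s` vanish almost everywhere, against positivity
  -- of the sum of the marginals.
  have z₁ : marginal₁ g s = 0 := integral_eq_zero_of_ae (by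
    filter_upwards [hs1] with u hu
    by_contra hne
    exact hps (hu hne).1)
  have z₂ : marginal₂ g s = 0 := integral_eq_zero_of_ae (by
    filter_upwards [hs2] with u hu
    by_contra hne
    exact hps (hu hne).2)
  linarith [h.marginal_pos s hs]

/-- Needed at the left end point, where there are no points of agreement further to the left. -/
lemma SeparatedCase.cdf_zero [IsProbabilityMeasure ν] (h : SeparatedCase M ε ν g) :
    cdf ν 0 = 0 := by
  have hneg : ∀ s < 0, cdf ν s = 0 := fun s hs => by
    rw [cdf_eq_real, measureReal_eq_zero_iff]
    exact measure_mono_null (t := (Icc 0 M)ᶜ)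
      (fun y (hy : y ≤ s) (hm : y ∈ Icc 0 M) => by linarith [hm.1]) h.F_supp
  refine tendsto_nhds_unique (h.F_cont.continuousAt.tendsto.mono_left
    (nhdsWithin_le_nhds (s := Iio 0))) ?_
  refine tendsto_const_nhds.congr' ?_
  filter_upwards [self_mem_nhdsWithin] with s hs using (hneg s hs).symm

lemma SeparatedCase.isDistFun_cdf (h : SeparatedCase M ε ν g) : IsDistFun M (cdf ν) where
  mono := (monotone_cdf ν).monotoneOn _
  right_cont _ _ := h.F_cont.continuousWithinAt
  mem_unit t _ := ⟨cdf_nonneg ν t, cdf_le_one ν t⟩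

/-- A monotone function that agrees with the distribution function at almost all observation points
agrees with it on `[0, M)`. -/
lemma SeparatedCase.eq_cdf_of_ae [IsProbabilityMeasure ν] (h : SeparatedCase M ε ν g) {F : ℝ → ℝ}
    (hF : Monotone F) (hF0 : ∀ s, 0 ≤ F s)
    (hae : ∀ᵐ z ∂obsLaw g, F z.1 = cdf ν z.1 ∧ F z.2 = cdf ν z.2) {t : ℝ} (ht : t ∈ Ico 0 M) :
    F t = cdf ν t := by
  have hae' := h.ae_of_ae_obsLaw (p := fun s => F s = cdf ν s) hae
  -- Points of agreement are dense in `[0, M]`. The upper bound at `t` uses one to the right of `t`,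
  -- hence `t < M`; the lower bound uses one to the left.
  have hex : ∀ a c, 0 ≤ a → a < c → c ≤ M → ∃ s ∈ Ioo a c, F s = cdf ν s := by
    intro a c ha hac hc
    by_contra! hno
    have hz : volume (Ioo a c) = 0 := by
      refine measure_mono_null (fun s hs => ?_) hae'
      exact fun himp => hno s hs (himp ⟨ha.trans hs.1.le, hs.2.le.trans hc⟩)
    simp [Real.volume_Ioo] at hz
    linarith
  refine le_antisymm ?_ ?_
  · by_contra! hlt
    obtain ⟨η, hη, hη'⟩ := Metric.eventually_nhds_iff.1
      (h.F_cont.continuousAt.eventually (gt_mem_nhds hlt))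
    obtain ⟨s, hs, hFs⟩ := hex t (min M (t + η)) ht.1 (lt_min ht.2 (by linarith))
      (min_le_left _ _)
    have h1 := hη' (y := s) (by
      rw [Real.dist_eq, abs_lt]
      exact ⟨by linarith [hs.1], by linarith [hs.2.trans_le (min_le_right _ _)]⟩)
    linarith [hF hs.1.le]
  · rcases ht.1.eq_or_lt with rfl | h0
    · rw [h.cdf_zero]; exact hF0 _
    by_contra! hlt
    obtain ⟨η, hη, hη'⟩ := Metric.eventually_nhds_iff.1
      (h.F_cont.continuousAt.eventually (lt_mem_nhds hlt))
    obtain ⟨s, hs, hFs⟩ := hex (max 0 (t - η)) t (le_max_left _ _) (max_lt h0 (by linarith)) ht.2.le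
    have h1 := hη' (y := s) (by
      rw [Real.dist_eq, abs_lt]
      exact ⟨by linarith [(le_max_right _ _).trans_lt hs.1], by linarith [hs.2]⟩)
    linarith [hF hs.2.le]

end ObservationLaw

/-- Pointwise convergence of monotone functions to a continuous function on an open interval is
uniform on compact subintervals. -/
lemma tendstoUniformlyOn_of_monotoneOn {F : ℕ → ℝ → ℝ} {G : ℝ → ℝ} {m M a c : ℝ}
    (hF : ∀ᶠ n in atTop, MonotoneOn (F n) (Icc m M)) (hG : Continuous G)
    (hlim : ∀ t ∈ Ioo m M, Tendsto (fun n => F n t) atTop (𝓝 (G t))) (ha : m < a) (hc : c < M) :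
    TendstoUniformlyOn F G atTop (Icc a c) := by
  rw [← tendstoLocallyUniformlyOn_iff_tendstoUniformlyOn_of_compact isCompact_Icc,
    Metric.tendstoLocallyUniformlyOn_iff]
  intro ε hε x hx
  obtain ⟨η, hη, hη'⟩ := Metric.continuousAt_iff.1 (hG.continuousAt (x := x)) (ε / 4) (by positivity)
  -- Keeps `x - r` and `x + r` inside `(m, M)`. Values near `x` are trapped between those at these
  -- two points, at a cost of three errors of `ε / 4`.
  set r := min (η / 2) (min ((x - m) / 2) ((M - x) / 2)) with hr
  have hr0 : 0 < r := lt_min (by positivity)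
    (lt_min (by linarith [hx.1]) (by linarith [hx.2]))
  have r1 : r ≤ η / 2 := min_le_left _ _
  have r2 : r ≤ (x - m) / 2 := (min_le_right _ _).trans (min_le_left _ _)
  have r3 : r ≤ (M - x) / 2 := (min_le_right _ _).trans (min_le_right _ _)
  have hl := (hlim (x - r) ⟨by linarith, by linarith⟩).eventually
    (Metric.ball_mem_nhds _ (by positivity : 0 < ε / 4))
  have hu := (hlim (x + r) ⟨by linarith, by linarith⟩).eventually
    (Metric.ball_mem_nhds _ (by positivity : 0 < ε / 4))
  refine ⟨Icc (x - r) (x + r), mem_nhdsWithin_of_mem_nhds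
    (Icc_mem_nhds (by linarith) (by linarith)), ?_⟩
  filter_upwards [hl, hu, hF] with n h1 h2 hmono y hy
  have m1 := hmono (a := x - r) (b := y) ⟨by linarith, by linarith⟩
    ⟨by linarith [hy.1], by linarith [hy.2]⟩ hy.1
  have m2 := hmono (a := y) (b := x + r) ⟨by linarith [hy.1], by linarith [hy.2]⟩
    ⟨by linarith, by linarith⟩ hy.2
  have g : ∀ z, |z - x| ≤ r → |G z - G x| < ε / 4 := fun z hz => by
    rw [← Real.dist_eq]
    exact hη' (by rw [Real.dist_eq]; linarith)
  have g1 := abs_lt.1 (g (x - r) (by rw [sub_sub_cancel_left, abs_neg, abs_of_pos hr0]))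
  have g2 := abs_lt.1 (g (x + r) (by rw [add_sub_cancel_left, abs_of_pos hr0]))
  have g3 := abs_lt.1 (g y (abs_le.2 ⟨by linarith [hy.1], by linarith [hy.2]⟩))
  rw [Real.dist_eq, abs_lt] at h1 h2
  rw [Real.dist_eq, abs_lt]
  constructor <;> linarith


/-! ### Extension of estimates from `[0, M]` to the line -/

section Extension

variable {M : ℝ} {h₁ h₂ : ℝ → ℝ} {h : ℝ → ℝ → ℝ} {F F' : ℝ → ℝ}

/-- An estimate is constrained only on `[0, M]`, so it may be replaced by a globally monotone
version, which grid points outside the interval require. -/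
lemma IsMaximizer.congr (hF : IsMaximizer M h₁ h₂ h F) (heq : EqOn F F' (Icc 0 M)) :
    IsMaximizer M h₁ h₂ h F' := by
  refine ⟨⟨hF.1.mono.congr heq, fun t ht => ?_, fun t ht => heq ht ▸ hF.1.mem_unit t ht⟩,
    fun G hG => ?_⟩
  · have hsub : Icc t M ⊆ Icc 0 M := Icc_subset_Icc_left ht.1
    exact (hF.1.right_cont t ht).congr (fun s hs => (heq (hsub hs)).symm)
      (heq ⟨ht.1, ht.2.le⟩).symm
  · have hlik : logLik M h₁ h₂ h F' = logLik M h₁ h₂ h F := by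
      have e₁ : ∫⁻ t in Icc 0 M, ENNReal.ofReal (h₁ t) * negLog (F' t) =
          ∫⁻ t in Icc 0 M, ENNReal.ofReal (h₁ t) * negLog (F t) :=
        setLIntegral_congr_fun measurableSet_Icc fun t ht => by simp only [heq ht]
      have e₂ : ∫⁻ t in Icc 0 M, ENNReal.ofReal (h₂ t) * negLog (1 - F' t) =
          ∫⁻ t in Icc 0 M, ENNReal.ofReal (h₂ t) * negLog (1 - F t) :=
        setLIntegral_congr_fun measurableSet_Icc fun t ht => by simp only [heq ht]
      have e₃ : ∫⁻ p in Icc (0 : ℝ) M ×ˢ Icc (0 : ℝ) M,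
            ENNReal.ofReal (h p.1 p.2) * negLog (F' p.2 - F' p.1) =
          ∫⁻ p in Icc (0 : ℝ) M ×ˢ Icc (0 : ℝ) M,
            ENNReal.ofReal (h p.1 p.2) * negLog (F p.2 - F p.1) :=
        setLIntegral_congr_fun (measurableSet_Icc.prod measurableSet_Icc)
          fun p hp => by simp only [heq hp.1, heq hp.2]
      rw [logLik, logLik, e₁, e₂, e₃]
    rw [hlik]
    exact hF.2 G hG

/-- The extension of a function on `[0, M]` that is constant to the left and to the right. -/
def clampExtend (M : ℝ) (F : ℝ → ℝ) (s : ℝ) : ℝ := F (max 0 (min M s))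

lemma clamp_mem (hM : 0 ≤ M) (s : ℝ) : max 0 (min M s) ∈ Icc 0 M :=
  ⟨le_max_left _ _, max_le hM (min_le_left _ _)⟩

lemma eqOn_clampExtend (M : ℝ) (F : ℝ → ℝ) : EqOn F (clampExtend M F) (Icc 0 M) := fun s hs => by
  rw [clampExtend, min_eq_right hs.2, max_eq_right hs.1]

lemma IsDistFun.monotone_clampExtend (hM : 0 ≤ M) (hF : IsDistFun M F) :
    Monotone (clampExtend M F) := fun _ _ hxy =>
  hF.mono (clamp_mem hM _) (clamp_mem hM _) (max_le_max le_rfl (min_le_min le_rfl hxy))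

lemma IsDistFun.clampExtend_mem (hM : 0 ≤ M) (hF : IsDistFun M F) (s : ℝ) :
    clampExtend M F s ∈ Icc (0 : ℝ) 1 := hF.mem_unit _ (clamp_mem hM _)

end Extension

/-! ### Limits in the sample size and in the mesh -/

section CellLimits

variable {δ M : ℝ}

lemma abs_atom_le (j k : ℕ) (t u : ℝ) : |atom δ M j k t u| ≤ 1 := by
  have h := cellwise_mem_Icc (δ := δ) (M := M) (t := t) (u := u)
    (f := fun j' k' => if j' = j ∧ k' = k then 1 else 0) zero_le_one
    (by split_ifs <;> simp)
  exact abs_le.2 ⟨by linarith [h.1, show atom δ M j k t u = cellwise δ M _ t u from rfl], h.2⟩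

lemma measurable_atom (j k : ℕ) : Measurable fun p : ℝ × ℝ => atom δ M j k p.1 p.2 :=
  measurable_cellwise δ M _

lemma integrable_mul_atom {μ : Measure (ℝ × ℝ)} [IsProbabilityMeasure μ] {q : ℝ × ℝ → ℝ}
    (hq : Measurable q) (hq1 : ∀ p, |q p| ≤ 1) (j k : ℕ) :
    Integrable (fun p => q p * atom δ M j k p.1 p.2) μ := by
  refine Integrable.of_bound (hq.mul (measurable_atom j k)).aestronglyMeasurable (1 * 1)
    (ae_of_all _ fun p => ?_)
  rw [Real.norm_eq_abs, abs_mul]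
  exact mul_le_mul (hq1 p) (abs_atom_le _ _ _ _) (abs_nonneg _) zero_le_one

lemma tendsto_average_cellwise (hδ : 0 < δ) {l : Filter ℕ} {D t u : ℕ → ℝ}
    {f : ℕ → ℕ → ℕ → ℝ} {f₀ : ℕ → ℕ → ℝ} {μ : Measure (ℝ × ℝ)} [IsProbabilityMeasure μ]
    {q : ℝ × ℝ → ℝ} (hq : Measurable q) (hq1 : ∀ p, |q p| ≤ 1)
    (hav : ∀ j k, Tendsto (fun n : ℕ => (1 / (n : ℝ)) *
      ∑ i ∈ Finset.range n, D i * atom δ M j k (t i) (u i)) l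
      (𝓝 (∫ p, q p * atom δ M j k p.1 p.2 ∂μ)))
    (hf : ∀ j k, Tendsto (fun n => f n j k) l (𝓝 (f₀ j k))) :
    Tendsto (fun n : ℕ => (1 / (n : ℝ)) *
      ∑ i ∈ Finset.range n, D i * cellwise δ M (f n) (t i) (u i)) l
      (𝓝 (∫ p, q p * cellwise δ M f₀ p.1 p.2 ∂μ)) := by
  set R := Finset.range (⌊M / δ⌋₊ + 1) with hR
  have h1 : ∀ n : ℕ, (1 / (n : ℝ)) *
      ∑ i ∈ Finset.range n, D i * cellwise δ M (f n) (t i) (u i) =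
      ∑ j ∈ R, ∑ k ∈ R, ((1 / (n : ℝ)) *
        ∑ i ∈ Finset.range n, D i * atom δ M j k (t i) (u i)) * f n j k := by
    intro n
    simp_rw [cellwise_eq_sum hδ (f n), Finset.mul_sum, Finset.sum_mul]
    rw [Finset.sum_comm]
    refine Finset.sum_congr rfl fun j _ => ?_
    rw [Finset.sum_comm]
    exact Finset.sum_congr rfl fun k _ => Finset.sum_congr rfl fun i _ => by ring
  have h2 : ∫ p, q p * cellwise δ M f₀ p.1 p.2 ∂μ =
      ∑ j ∈ R, ∑ k ∈ R, (∫ p, q p * atom δ M j k p.1 p.2 ∂μ) * f₀ j k := by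
    simp_rw [cellwise_eq_sum hδ f₀, Finset.mul_sum, ← mul_assoc]
    rw [integral_finsetSum _ fun j _ => integrable_finsetSum _ fun k _ =>
      (integrable_mul_atom hq hq1 j k).mul_const _]
    refine Finset.sum_congr rfl fun j _ => ?_
    rw [integral_finsetSum _ fun k _ => (integrable_mul_atom hq hq1 j k).mul_const _]
    exact Finset.sum_congr rfl fun k _ => integral_mul_const _ _
  simp_rw [h1, h2]
  exact tendsto_finsetSum _ fun j _ => tendsto_finsetSum _ fun k _ => (hav j k).mul (hf j k)

/-- The mesh sizes. -/
noncomputable def mesh (m : ℕ) : ℝ := 1 / ((m : ℝ) + 1)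

lemma mesh_pos (m : ℕ) : 0 < mesh m := by unfold mesh; positivity

lemma tendsto_mesh : Tendsto mesh atTop (𝓝 0) := tendsto_one_div_add_atTop_nhds_zero_nat

lemma tendsto_grid {x : ℝ} (hx : 0 ≤ x) {a : ℝ} :
    Tendsto (fun m => (⌊x / mesh m⌋₊ + a) * mesh m) atTop (𝓝 x) := by
  have h1 : Tendsto (fun m => x + (a - 1) * mesh m) atTop (𝓝 x) := by
    simpa using (tendsto_mesh.const_mul (a - 1)).const_add x
  have h2 : Tendsto (fun m => x + a * mesh m) atTop (𝓝 x) := by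
    simpa using (tendsto_mesh.const_mul a).const_add x
  refine tendsto_of_tendsto_of_tendsto_of_le_of_le h1 h2 (fun m => ?_) (fun m => ?_)
  · have := lt_floor_add_one_mul (mesh_pos m) x
    dsimp only; nlinarith
  · have := floor_mul_le (mesh_pos m) hx
    dsimp only; nlinarith

lemma eventually_mem_Icc_mesh {x : ℝ} (hx : x ∈ Ioo 0 M) :
    ∀ᶠ m in atTop, x ∈ Icc (2 * mesh m) (M - 2 * mesh m) := by
  have h1 : ∀ᶠ m in atTop, mesh m < min (x / 2) ((M - x) / 2) :=
    tendsto_mesh.eventually (gt_mem_nhds (lt_min (by linarith [hx.1]) (by linarith [hx.2])))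
  filter_upwards [h1] with m hm
  have h2 := hm.trans_le (min_le_left _ _)
  have h3 := hm.trans_le (min_le_right _ _)
  exact ⟨by linarith, by linarith⟩

lemma eventually_cellwise_eq {p : ℝ × ℝ} (hp : p.1 ∈ Ioo 0 M ∧ p.2 ∈ Ioo 0 M)
    (f : ℕ → ℕ → ℕ → ℝ) :
    ∀ᶠ m in atTop, cellwise (mesh m) M (f m) p.1 p.2 = f m ⌊p.1 / mesh m⌋₊ ⌊p.2 / mesh m⌋₊ := by
  filter_upwards [eventually_mem_Icc_mesh hp.1, eventually_mem_Icc_mesh hp.2] with m h1 h2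
  exact if_pos ⟨h1, h2⟩

variable {G F : ℝ → ℝ} {p : ℝ × ℝ}

lemma tendsto_mul_cellwise {c : ℝ} {f : ℕ → ℕ → ℕ → ℝ} {y : ℝ}
    (hp : p.1 ∈ Ioo 0 M ∧ p.2 ∈ Ioo 0 M)
    (h : Tendsto (fun m => c * f m ⌊p.1 / mesh m⌋₊ ⌊p.2 / mesh m⌋₊) atTop (𝓝 y)) :
    Tendsto (fun m => c * cellwise (mesh m) M (f m) p.1 p.2) atTop (𝓝 y) := by
  refine h.congr' ?_
  filter_upwards [eventually_cellwise_eq hp f] with m hm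
  rw [hm]

lemma tendsto_comp_grid {H : ℝ → ℝ} {x : ℝ} (hx : 0 ≤ x) (hH : ContinuousAt H x) :
    Tendsto (fun m => H ((⌊x / mesh m⌋₊ - 1) * mesh m)) atTop (𝓝 (H x)) ∧
      Tendsto (fun m => H ((⌊x / mesh m⌋₊ + 2) * mesh m)) atTop (𝓝 (H x)) :=
  ⟨hH.tendsto.comp (by simpa only [sub_eq_add_neg] using tendsto_grid hx (a := -1)),
    hH.tendsto.comp (tendsto_grid hx)⟩

lemma tendsto_coeff₁ (hp : p.1 ∈ Ioo 0 M ∧ p.2 ∈ Ioo 0 M) (hG : Continuous G)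
    (hG1 : ∀ x, G x ∈ Icc (0 : ℝ) 1) (hF1 : ∀ x, F x ∈ Icc (0 : ℝ) 1)
    (hF : ContinuousAt F p.1) :
    Tendsto (fun m => G p.1 * cellwise (mesh m) M (coeff₁ (mesh m) G F) p.1 p.2) atTop
      (𝓝 (G p.1 * ratio (G p.1) (F p.1))) :=
  tendsto_mul_cellwise hp (tendsto_mul_ratio (tendsto_comp_grid hp.1.1.le hG.continuousAt).1
    (tendsto_comp_grid hp.1.1.le hF).2 (hG1 _).1 (hF1 _).1)

lemma tendsto_coeff₃ (hp : p.1 ∈ Ioo 0 M ∧ p.2 ∈ Ioo 0 M) (hG : Continuous G)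
    (hG1 : ∀ x, G x ∈ Icc (0 : ℝ) 1) (hF1 : ∀ x, F x ∈ Icc (0 : ℝ) 1)
    (hF : ContinuousAt F p.2) :
    Tendsto (fun m => (1 - G p.2) * cellwise (mesh m) M (coeff₃ (mesh m) G F) p.1 p.2) atTop
      (𝓝 ((1 - G p.2) * ratio (1 - G p.2) (1 - F p.2))) :=
  tendsto_mul_cellwise hp (tendsto_mul_ratio
    ((tendsto_comp_grid hp.2.1.le hG.continuousAt).2.const_sub 1)
    ((tendsto_comp_grid hp.2.1.le hF).1.const_sub 1)
    (sub_nonneg.2 (hG1 _).2) (sub_nonneg.2 (hF1 _).2))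

lemma tendsto_coeff₂ (hp : p.1 ∈ Ioo 0 M ∧ p.2 ∈ Ioo 0 M) (hG : Continuous G)
    (hGp : G p.1 ≤ G p.2) (hFp : F p.1 ≤ F p.2)
    (hF₁ : ContinuousAt F p.1) (hF₂ : ContinuousAt F p.2) :
    Tendsto (fun m => (G p.2 - G p.1) * cellwise (mesh m) M (coeff₂ (mesh m) G F) p.1 p.2) atTop
      (𝓝 ((G p.2 - G p.1) * ratio (G p.2 - G p.1) (F p.2 - F p.1))) := by
  refine tendsto_mul_cellwise hp (tendsto_mul_ratio ?_ ?_ (sub_nonneg.2 hGp) (sub_nonneg.2 hFp))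
  · have := (tendsto_const_nhds (x := (0 : ℝ))).max
      ((tendsto_comp_grid hp.2.1.le hG.continuousAt).1.sub
        (tendsto_comp_grid hp.1.1.le hG.continuousAt).2)
    rwa [max_eq_right (sub_nonneg.2 hGp)] at this
  · have := (tendsto_const_nhds (x := (0 : ℝ))).max
      ((tendsto_comp_grid hp.2.1.le hF₂).2.sub (tendsto_comp_grid hp.1.1.le hF₁).1)
    rwa [max_eq_right (sub_nonneg.2 hFp)] at this

lemma tendsto_integral_mul_cellwise {μ : Measure (ℝ × ℝ)} [IsProbabilityMeasure μ]
    {q r : ℝ × ℝ → ℝ} {f : ℕ → ℕ → ℕ → ℝ} (hq : Measurable q) (hq1 : ∀ p, |q p| ≤ 1)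
    (hf : ∀ m j k, f m j k ∈ Icc (0 : ℝ) 2)
    (h : ∀ᵐ p ∂μ, Tendsto (fun m => q p * cellwise (mesh m) M (f m) p.1 p.2) atTop (𝓝 (r p))) :
    Tendsto (fun m => ∫ p, q p * cellwise (mesh m) M (f m) p.1 p.2 ∂μ) atTop
      (𝓝 (∫ p, r p ∂μ)) := by
  refine tendsto_integral_of_dominated_convergence (fun _ => 1 * 2)
    (fun m => (hq.mul (measurable_cellwise _ _ _)).aestronglyMeasurable) (integrable_const _)
    (fun m => ae_of_all _ fun p => ?_) h
  have hm := cellwise_mem_Icc (δ := mesh m) (M := M) (t := p.1) (u := p.2) zero_le_two (hf m _ _)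
  rw [Real.norm_eq_abs, abs_mul, abs_of_nonneg hm.1]
  exact mul_le_mul (hq1 p) hm.2 hm.1 zero_le_one

/-- The excess mass of the boundary weights does not become small at a given boundary point, but it
concerns only strips that shrink to a null set. -/
lemma tendsto_integral_edgeFactor {C : ℝ} (hC : 0 ≤ C) {μ : Measure (ℝ × ℝ)}
    [IsProbabilityMeasure μ] (hμ : ∀ᵐ p ∂μ, p.1 ∈ Ioo 0 M ∧ p.2 ∈ Ioo 0 M) :
    Tendsto (fun m => ∫ p, edgeFactor C (mesh m) M p.1 * edgeFactor C (mesh m) M p.2 ∂μ) atTop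
      (𝓝 1) := by
  have h1 : ∫ _ : ℝ × ℝ, (1 : ℝ) ∂μ = 1 := by simp
  rw [← h1]
  refine tendsto_integral_of_dominated_convergence (fun _ => (1 + 2 * C) * (1 + 2 * C))
    (fun m => (((measurable_edgeFactor _ _ _).comp measurable_fst).mul
      ((measurable_edgeFactor _ _ _).comp measurable_snd)).aestronglyMeasurable)
    (integrable_const _) (fun m => ae_of_all _ fun p => ?_) ?_
  · have a1 := zero_le_one.trans (one_le_edgeFactor hC (mesh m) M p.1)
    have a2 := zero_le_one.trans (one_le_edgeFactor hC (mesh m) M p.2)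
    rw [Real.norm_eq_abs, abs_of_nonneg (mul_nonneg a1 a2)]
    exact mul_le_mul (edgeFactor_le hC _ _ _) (edgeFactor_le hC _ _ _) a2 (by positivity)
  · filter_upwards [hμ] with p hp
    refine tendsto_const_nhds.congr' ?_
    filter_upwards [eventually_mem_Icc_mesh hp.1, eventually_mem_Icc_mesh hp.2] with m m1 m2
    simp [edgeFactor, m1, m2]

end CellLimits

/-! ### Identification of the limit -/

section Identification

variable {μ : Measure (ℝ × ℝ)} [IsProbabilityMeasure μ] {G F : ℝ → ℝ}

/-- The limiting inequality identifies the limit of the estimates. -/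
lemma ae_eq_of_integral_ratio_le_one (hGm : Monotone G) (hFm : Monotone F)
    (hG1 : ∀ x, G x ∈ Icc (0 : ℝ) 1) (hF1 : ∀ x, F x ∈ Icc (0 : ℝ) 1)
    (hμ : ∀ᵐ p ∂μ, p.1 ≤ p.2)
    (h : ∫ p, G p.1 * ratio (G p.1) (F p.1) ∂μ +
      ∫ p, (1 - G p.2) * ratio (1 - G p.2) (1 - F p.2) ∂μ +
      ∫ p, (G p.2 - G p.1) * ratio (G p.2 - G p.1) (F p.2 - F p.1) ∂μ ≤ 1) :
    ∀ᵐ p ∂μ, F p.1 = G p.1 ∧ F p.2 = G p.2 := by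
  have hG := hGm.measurable
  have hF := hFm.measurable
  have hr : ∀ {a c : ℝ × ℝ → ℝ}, Measurable a → Measurable c →
      (∀ᵐ p ∂μ, 0 ≤ a p ∧ a p ≤ 1 ∧ 0 ≤ c p) →
      Integrable (fun p => a p * ratio (a p) (c p)) μ := by
    intro a c ha hc hac
    refine Integrable.of_bound
      (ha.mul (measurable_ratio.comp (ha.prodMk hc))).aestronglyMeasurable (1 * 2) ?_
    filter_upwards [hac] with p hp
    have h0 := ratio_nonneg hp.1 hp.2.2
    rw [Real.norm_eq_abs, abs_of_nonneg (mul_nonneg hp.1 h0)]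
    exact mul_le_mul hp.2.1 (ratio_le_two hp.1 hp.2.2) h0 zero_le_one
  have i₁ : Integrable (fun p => G p.1 * ratio (G p.1) (F p.1)) μ := hr (hG.comp measurable_fst) (hF.comp measurable_fst)
    (ae_of_all _ fun p => ⟨(hG1 _).1, (hG1 _).2, (hF1 _).1⟩)
  have i₃ : Integrable (fun p => (1 - G p.2) * ratio (1 - G p.2) (1 - F p.2)) μ := hr ((hG.comp measurable_snd).const_sub 1) ((hF.comp measurable_snd).const_sub 1)
    (ae_of_all _ fun p => ⟨sub_nonneg.2 (hG1 _).2, sub_le_self _ (hG1 _).1, sub_nonneg.2 (hF1 _).2⟩)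
  have i₂ : Integrable (fun p => (G p.2 - G p.1) * ratio (G p.2 - G p.1) (F p.2 - F p.1)) μ := hr ((hG.comp measurable_snd).sub (hG.comp measurable_fst))
    ((hF.comp measurable_snd).sub (hF.comp measurable_fst)) (by
      filter_upwards [hμ] with p hp
      exact ⟨sub_nonneg.2 (hGm hp), (sub_le_self _ (hG1 _).1).trans (hG1 _).2,
        sub_nonneg.2 (hFm hp)⟩)
  set d : ℝ × ℝ → ℝ := fun p => ((G p.1 - F p.1) ^ 2 + (G p.2 - F p.2) ^ 2) / 4 with hd
  have hd0 : ∀ p, 0 ≤ d p := fun p => by positivity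
  have hdi : Integrable d μ := by
    refine Integrable.of_bound (by fun_prop) 1 (ae_of_all _ fun p => ?_)
    rw [Real.norm_eq_abs, abs_of_nonneg (hd0 p)]
    have e : ∀ s, (G s - F s) ^ 2 ≤ 1 := fun s => by
      rw [sq_le_one_iff_abs_le_one, abs_le]
      exact ⟨by linarith [(hG1 s).1, (hF1 s).2], by linarith [(hG1 s).2, (hF1 s).1]⟩
    simp only [hd]
    linarith [e p.1, e p.2]
  have hle : ∫ p, (1 + d p) ∂μ ≤ 1 := by
    refine le_trans ?_ h
    have i₁₃ : Integrable (fun p => G p.1 * ratio (G p.1) (F p.1) +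
        (1 - G p.2) * ratio (1 - G p.2) (1 - F p.2)) μ := i₁.add i₃
    rw [← integral_add i₁ i₃, ← integral_add i₁₃ i₂]
    refine integral_mono_ae ((integrable_const _).add hdi) (i₁₃.add i₂) ?_
    filter_upwards [hμ] with p hp
    -- In the sum of the three bounds the leading terms give 1 and the linear terms cancel. Two
    -- squares give `d p`, and the third, `a₄`, is dropped.
    have a₁ := mul_ratio_ge (hG1 p.1).1 (hG1 p.1).2 (hF1 p.1).1 (hF1 p.1).2
    have a₃ := mul_ratio_ge (sub_nonneg.2 (hG1 p.2).2) (sub_le_self _ (hG1 p.2).1)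
      (sub_nonneg.2 (hF1 p.2).2) (sub_le_self _ (hF1 p.2).1)
    have a₂ := mul_ratio_ge (sub_nonneg.2 (hGm hp)) ((sub_le_self _ (hG1 p.1).1).trans (hG1 p.2).2)
      (sub_nonneg.2 (hFm hp)) ((sub_le_self _ (hF1 p.1).1).trans (hF1 p.2).2)
    have a₄ := sq_nonneg (G p.2 - G p.1 - (F p.2 - F p.1))
    have e : (1 - G p.2 - (1 - F p.2)) ^ 2 = (G p.2 - F p.2) ^ 2 := by ring
    rw [e] at a₃
    simp only [hd]
    linarith
  rw [integral_add (integrable_const _) hdi] at hle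
  have hz : ∫ p, d p ∂μ = 0 := by
    refine le_antisymm ?_ (integral_nonneg hd0)
    simpa using hle
  rw [integral_eq_zero_iff_of_nonneg hd0 hdi] at hz
  filter_upwards [hz] with p hp
  have hp' : ((G p.1 - F p.1) ^ 2 + (G p.2 - F p.2) ^ 2) / 4 = 0 := hp
  have s1 := sq_nonneg (G p.1 - F p.1)
  have s2 := sq_nonneg (G p.2 - F p.2)
  exact ⟨(sub_eq_zero.1 (pow_eq_zero_iff two_ne_zero |>.1 (by linarith))).symm,
    (sub_eq_zero.1 (pow_eq_zero_iff two_ne_zero |>.1 (by linarith))).symm⟩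

end Identification


/-! ### Pointwise consistency for fixed data -/

section Limit

/-- Pointwise consistency along a fixed sequence of data whose averages converge. -/
lemma tendsto_cdf_of_tendsto_averages {M ε C : ℝ} {ν : Measure ℝ} [IsProbabilityMeasure ν]
    {g : ℝ → ℝ → ℝ} [IsProbabilityMeasure (obsLaw g)] (h : SeparatedCase M ε ν g) {K α β : ℝ → ℝ}
    (hK : IsKernel K) (hα : ContinuousOn α (Icc 0 1)) (hβ : ContinuousOn β (Icc 0 1))
    (hC : ∀ u ∈ Icc (0 : ℝ) 1, |α u| ≤ C ∧ |β u| ≤ C) {b : ℕ → ℝ}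
    (hb_pos : ∀ n, 1 ≤ n → 0 < b n) (hb_lim : Tendsto b atTop (𝓝 0)) {x t u : ℕ → ℝ}
    (hε : ∀ i, ε ≤ u i - t i) {F : ℕ → ℝ → ℝ}
    (hF : ∀ n, 1 ≤ n → IsMSLE K α β M (b n) n x t u (F n))
    (hav₁ : ∀ m j k, Tendsto (fun n : ℕ => (1 / (n : ℝ)) * ∑ i ∈ Finset.range n,
      Δ₁ (x i) (t i) * atom (mesh m) M j k (t i) (u i)) atTop
      (𝓝 (∫ p, cdf ν p.1 * atom (mesh m) M j k p.1 p.2 ∂obsLaw g)))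
    (hav₂ : ∀ m j k, Tendsto (fun n : ℕ => (1 / (n : ℝ)) * ∑ i ∈ Finset.range n,
      Δ₂ (x i) (t i) (u i) * atom (mesh m) M j k (t i) (u i)) atTop
      (𝓝 (∫ p, (cdf ν p.2 - cdf ν p.1) * atom (mesh m) M j k p.1 p.2 ∂obsLaw g)))
    (hav₃ : ∀ m j k, Tendsto (fun n : ℕ => (1 / (n : ℝ)) * ∑ i ∈ Finset.range n,
      Δ₃ (x i) (t i) (u i) * atom (mesh m) M j k (t i) (u i)) atTop
      (𝓝 (∫ p, (1 - cdf ν p.2) * atom (mesh m) M j k p.1 p.2 ∂obsLaw g)))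
    (hedge : ∀ m, Tendsto (fun n : ℕ => (1 / (n : ℝ)) * ∑ i ∈ Finset.range n,
      edgeFactor C (mesh m) M (t i) * edgeFactor C (mesh m) M (u i)) atTop
      (𝓝 (∫ p, edgeFactor C (mesh m) M p.1 * edgeFactor C (mesh m) M p.2 ∂obsLaw g)))
    {s : ℝ} (hs : s ∈ Ico 0 M) : Tendsto (fun n => F n s) atTop (𝓝 (cdf ν s)) := by
  -- Along an ultrafilter every bounded sequence converges, so all values of the estimates have
  -- limits at once; this takes the place of Helly's selection theorem.
  rw [tendsto_iff_ultrafilter]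
  intro l hl
  have hM := h.M_pos
  have hC0 : 0 ≤ C := (abs_nonneg _).trans (hC 0 (by simp)).1
  have hn1 : ∀ᶠ n in (l : Filter ℕ), 1 ≤ n := hl (eventually_ge_atTop 1)
  set E : ℕ → ℝ → ℝ := fun n => clampExtend M (F n) with hE
  have hEm : ∀ n, 1 ≤ n → Monotone (E n) := fun n hn => (hF n hn).1.monotone_clampExtend hM.le
  have hE1 : ∀ n, 1 ≤ n → ∀ y, E n y ∈ Icc (0 : ℝ) 1 := fun n hn => (hF n hn).1.clampExtend_mem hM.le
  have hlim : ∀ y, ∃ z ∈ Icc (0 : ℝ) 1, Tendsto (fun n => E n y) l (𝓝 z) := fun y =>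
    isCompact_Icc.ultrafilter_le_nhds (l.map fun n => E n y) (by
      rw [le_principal_iff]
      exact hn1.mono fun n hn => hE1 n hn y)
  choose L hL1 hL using hlim
  have hLm : Monotone L := fun y z hyz => le_of_tendsto_of_tendsto (hL y) (hL z) (by
    filter_upwards [hn1] with n hn using hEm n hn hyz)
  set G : ℝ → ℝ := fun y => cdf ν y with hG
  have hGm : Monotone G := monotone_cdf ν
  have hG1 : ∀ y, G y ∈ Icc (0 : ℝ) 1 := fun y => ⟨cdf_nonneg ν y, cdf_le_one ν y⟩
  have hq₁ : Measurable fun p : ℝ × ℝ => G p.1 := hGm.measurable.comp measurable_fst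
  have hq₃ : Measurable fun p : ℝ × ℝ => 1 - G p.2 :=
    (hGm.measurable.comp measurable_snd).const_sub 1
  have hq₂ : Measurable fun p : ℝ × ℝ => G p.2 - G p.1 :=
    (hGm.measurable.comp measurable_snd).sub hq₁
  have b₁ : ∀ p : ℝ × ℝ, |G p.1| ≤ 1 := fun p =>
    abs_le.2 ⟨by linarith [(hG1 p.1).1], (hG1 p.1).2⟩
  have b₃ : ∀ p : ℝ × ℝ, |1 - G p.2| ≤ 1 := fun p =>
    abs_le.2 ⟨by linarith [(hG1 p.2).2], by linarith [(hG1 p.2).1]⟩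
  have b₂ : ∀ p : ℝ × ℝ, |G p.2 - G p.1| ≤ 1 := fun p =>
    abs_le.2 ⟨by linarith [(hG1 p.1).2, (hG1 p.2).1], by linarith [(hG1 p.1).1, (hG1 p.2).2]⟩
  have hstep : ∀ m, ∫ p, G p.1 * cellwise (mesh m) M (coeff₁ (mesh m) G L) p.1 p.2 ∂obsLaw g +
      ∫ p, (1 - G p.2) * cellwise (mesh m) M (coeff₃ (mesh m) G L) p.1 p.2 ∂obsLaw g +
      ∫ p, (G p.2 - G p.1) * cellwise (mesh m) M (coeff₂ (mesh m) G L) p.1 p.2 ∂obsLaw g ≤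
      ∫ p, edgeFactor C (mesh m) M p.1 * edgeFactor C (mesh m) M p.2 ∂obsLaw g := by
    intro m
    have t₁ := tendsto_average_cellwise (f := fun n => coeff₁ (mesh m) G (E n)) (mesh_pos m) hq₁ b₁
      (fun j k => (hav₁ m j k).mono_left hl) (fun j k =>
        tendsto_ratio_right (hL ((j + 2) * mesh m)) (hG1 ((j - 1) * mesh m)).1 (hL1 _).1)
    have t₃ := tendsto_average_cellwise (f := fun n => coeff₃ (mesh m) G (E n)) (mesh_pos m) hq₃ b₃
      (fun j k => (hav₃ m j k).mono_left hl) (fun j k =>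
        tendsto_ratio_right ((hL ((k - 1) * mesh m)).const_sub 1)
          (sub_nonneg.2 (hG1 ((k + 2) * mesh m)).2) (sub_nonneg.2 (hL1 _).2))
    have t₂ := tendsto_average_cellwise (f := fun n => coeff₂ (mesh m) G (E n)) (mesh_pos m) hq₂ b₂
      (fun j k => (hav₂ m j k).mono_left hl) (fun j k =>
        tendsto_ratio_right (tendsto_const_nhds.max
          ((hL ((k + 2) * mesh m)).sub (hL ((j - 1) * mesh m)))) (le_max_left _ _) (le_max_left _ _))
    refine le_of_tendsto_of_tendsto ((t₁.add t₃).add t₂) ((hedge m).mono_left hl) ?_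
    -- The mesh stays fixed while `n` grows, so `b n → 0` is enough, without a rate.
    have hbm : ∀ᶠ n in (l : Filter ℕ), b n < min (mesh m) (ε / 2) :=
      hl (hb_lim.eventually (gt_mem_nhds (lt_min (mesh_pos m) (half_pos h.eps_pos))))
    filter_upwards [hn1, hbm] with n hn hb
    have hmain := IsMSLE.average_lowerRatio_le hK hα hβ hC (hb_pos n hn)
      (hb.trans_le (min_le_left _ _)).le (by linarith [hb.trans_le (min_le_right _ _)]) hM hε
      ((hF n hn).congr (eqOn_clampExtend M (F n))) (hEm n hn) (hE1 n hn)
      h.isDistFun_cdf hGm hG1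
    refine le_of_eq_of_le ?_ hmain
    simp only [lowerRatio, Finset.sum_add_distrib, mul_add]
    rfl
  have hIoo := h.ae_mem_Ioo
  have hord : ∀ᵐ p ∂obsLaw g, p.1 ≤ p.2 := by
    filter_upwards [h.ae_le_obsLaw] with p hp
    linarith [h.eps_pos]
  -- The limit `L` need not be right continuous. It is monotone, so its discontinuities are
  -- countable, and both coordinates of an observation avoid them almost surely.
  have hcont : ∀ᵐ y : ℝ, ContinuousAt L y := by
    rw [ae_iff]
    exact hLm.countable_not_continuousAt.measure_zero _
  have hc₁ := h.ae_fst_of_ae hcont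
  have hc₂ := h.ae_snd_of_ae hcont
  have d₁ := tendsto_integral_mul_cellwise (μ := obsLaw g)
    (f := fun m => coeff₁ (mesh m) G L) hq₁ b₁ (fun m => coeff₁_mem hG1 hL1) (by
      filter_upwards [hIoo, hc₁] with p hp hp1 using tendsto_coeff₁ hp h.F_cont hG1 hL1 hp1)
  have d₃ := tendsto_integral_mul_cellwise (μ := obsLaw g)
    (f := fun m => coeff₃ (mesh m) G L) hq₃ b₃ (fun m => coeff₃_mem hG1 hL1) (by
      filter_upwards [hIoo, hc₂] with p hp hp2 using tendsto_coeff₃ hp h.F_cont hG1 hL1 hp2)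
  have d₂ := tendsto_integral_mul_cellwise (μ := obsLaw g)
    (f := fun m => coeff₂ (mesh m) G L) hq₂ b₂ (fun m => coeff₂_mem) (by
      filter_upwards [hIoo, hc₁, hc₂, hord] with p hp hp1 hp2 hle using
        tendsto_coeff₂ hp h.F_cont (hGm hle) (hLm hle) hp1 hp2)
  have hle := le_of_tendsto_of_tendsto' ((d₁.add d₃).add d₂)
    (tendsto_integral_edgeFactor hC0 hIoo) hstep
  have hae := ae_eq_of_integral_ratio_le_one hGm hLm hG1 hL1 hord hle
  rw [← h.eq_cdf_of_ae hLm (fun y => (hL1 y).1) hae hs]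
  refine (hL s).congr fun n => ?_
  exact (eqOn_clampExtend M (F n) ⟨hs.1, hs.2.le⟩).symm

end Limit

/-! ### Almost sure convergence of the averages and the theorem -/

section Averages

variable {Ω : Type*} [MeasurableSpace Ω] {P : Measure Ω} [IsProbabilityMeasure P]
  {X T U : ℕ → Ω → ℝ} {ν : Measure ℝ} [IsProbabilityMeasure ν] {g : ℝ → ℝ → ℝ}

lemma IsSample.ae_tendsto_average_hidden (hs : IsSample P X T U ν g) {D : ℝ → ℝ × ℝ → ℝ}
    {q f : ℝ × ℝ → ℝ} {c : ℝ} (hD : Measurable fun z : ℝ × ℝ × ℝ => D z.1 z.2)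
    (hD1 : ∀ x p, |D x p| ≤ 1) (hf : Measurable f) (hc : ∀ p, |f p| ≤ c)
    (hq : ∀ᵐ p ∂obsLaw g, ∫ x, D x p ∂ν = q p) :
    ∀ᵐ ω ∂P, Tendsto (fun n : ℕ => (1 / (n : ℝ)) *
      ∑ i ∈ Finset.range n, D (X i ω) (T i ω, U i ω) * f (T i ω, U i ω)) atTop
      (𝓝 (∫ p, q p * f p ∂obsLaw g)) := by
  have := hs.isProbabilityMeasure_obsLaw
  rw [← integral_hidden hD hD1 hf hc hq]
  exact hs.ae_tendsto_average (f := fun z => D z.1 z.2 * f z.2) (c := 1 * c)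
    (hD.mul (hf.comp measurable_snd)) fun z => by
      rw [abs_mul]
      exact mul_le_mul (hD1 _ _) (hc _) (abs_nonneg _) zero_le_one

end Averages

end IntervalCensoring

theorem mainTheorem2 {Ω : Type*} [MeasurableSpace Ω] (P : Measure Ω) [IsProbabilityMeasure P]
    (X T U : ℕ → Ω → ℝ) (ν : Measure ℝ) [IsProbabilityMeasure ν] (g : ℝ → ℝ → ℝ) (M ε : ℝ)
    (hsample : IntervalCensoring.IsSample P X T U ν g)
    (hsep : IntervalCensoring.SeparatedCase M ε ν g)
    (K α β : ℝ → ℝ) (hK : IntervalCensoring.IsKernel K)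
    (hcoeff : IntervalCensoring.IsBoundaryCoeff K α β)
    (b : ℕ → ℝ) (hb_pos : ∀ n, 1 ≤ n → 0 < b n) (hb_lim : Tendsto b atTop (𝓝 0))
    (Fhat : ℕ → Ω → ℝ → ℝ)
    (hFhat : ∀ᵐ ω ∂P, ∀ n, 1 ≤ n →
      IntervalCensoring.IsMSLE K α β M (b n) n
        (fun i => X i ω) (fun i => T i ω) (fun i => U i ω) (Fhat n ω)) :
    ∀ᵐ ω ∂P,
      (∀ t ∈ Ico 0 M, Tendsto (fun n => Fhat n ω t) atTop (𝓝 (cdf ν t))) ∧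
      ∀ a c : ℝ, 0 < a → a ≤ c → c < M →
        TendstoUniformlyOn (fun n => Fhat n ω) (cdf ν) atTop (Icc a c) := by
  open IntervalCensoring in
  have := hsample.isProbabilityMeasure_obsLaw
  obtain ⟨C, hC⟩ := hcoeff.bounded
  have hC' : ∀ u ∈ Icc (0 : ℝ) 1, |α u| ≤ C ∧ |β u| ≤ C := fun u hu => ⟨(hC u hu).1, (hC u hu).2.1⟩
  have hC0 : 0 ≤ C := (abs_nonneg _).trans (hC' 0 (by simp)).1
  have hord : ∀ᵐ p ∂obsLaw g, p.1 ≤ p.2 := by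
    filter_upwards [hsep.ae_le_obsLaw] with p hp
    linarith [hsep.eps_pos]
  have hε : ∀ᵐ ω ∂P, ∀ i, ε ≤ U i ω - T i ω := by
    rw [ae_all_iff]
    intro i
    have h := hsep.ae_le_obsLaw
    rw [← hsample.law_TU i] at h
    exact ae_of_ae_map
      ((hsample.measurable_T i).prodMk (hsample.measurable_U i)).aemeasurable h
  have hav₁ := fun m j k => hsample.ae_tendsto_average_hidden (D := fun x p => Δ₁ x p.1)
    (q := fun p => cdf ν p.1) (f := fun p => atom (mesh m) M j k p.1 p.2) measurable_Δ₁
    (fun _ _ => abs_Δ₁_le _ _) (measurable_atom j k) (fun _ => abs_atom_le _ _ _ _)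
    (ae_of_all _ fun p => integral_Δ₁ p.1)
  have hav₂ := fun m j k => hsample.ae_tendsto_average_hidden (D := fun x p => Δ₂ x p.1 p.2)
    (q := fun p => cdf ν p.2 - cdf ν p.1) (f := fun p => atom (mesh m) M j k p.1 p.2) measurable_Δ₂
    (fun _ _ => abs_Δ₂_le _ _ _) (measurable_atom j k) (fun _ => abs_atom_le _ _ _ _)
    (hord.mono fun p hp => integral_Δ₂ hp)
  have hav₃ := fun m j k => hsample.ae_tendsto_average_hidden (D := fun x p => Δ₃ x p.1 p.2)
    (q := fun p => 1 - cdf ν p.2) (f := fun p => atom (mesh m) M j k p.1 p.2) measurable_Δ₃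
    (fun _ _ => abs_Δ₃_le _ _ _) (measurable_atom j k) (fun _ => abs_atom_le _ _ _ _)
    (hord.mono fun p hp => integral_Δ₃ hp)
  have hedge := fun m => hsample.ae_tendsto_average_hidden (D := fun _ _ => 1)
    (q := fun _ => 1) (f := fun p => edgeFactor C (mesh m) M p.1 * edgeFactor C (mesh m) M p.2)
    (c := (1 + 2 * C) * (1 + 2 * C)) measurable_const (fun _ _ => by simp)
    (((measurable_edgeFactor _ _ _).comp measurable_fst).mul
      ((measurable_edgeFactor _ _ _).comp measurable_snd))
    (fun p => by
      have a1 := zero_le_one.trans (one_le_edgeFactor hC0 (mesh m) M p.1)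
      have a2 := zero_le_one.trans (one_le_edgeFactor hC0 (mesh m) M p.2)
      rw [abs_of_nonneg (mul_nonneg a1 a2)]
      exact mul_le_mul (edgeFactor_le hC0 _ _ _) (edgeFactor_le hC0 _ _ _) a2 (by positivity))
    (ae_of_all _ fun p => by simp)
  simp only [one_mul] at hedge
  -- Meshes and cells are countable in number, so a single null set, independent of the point `t`,
  -- serves for all limits.
  filter_upwards [hFhat, hε, ae_all_iff.2 fun m => ae_all_iff.2 fun j => ae_all_iff.2 (hav₁ m j),
    ae_all_iff.2 fun m => ae_all_iff.2 fun j => ae_all_iff.2 (hav₂ m j),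
    ae_all_iff.2 fun m => ae_all_iff.2 fun j => ae_all_iff.2 (hav₃ m j),
    ae_all_iff.2 hedge] with ω hω hεω h1 h2 h3 h4
  have hlim : ∀ t ∈ Ico 0 M, Tendsto (fun n => Fhat n ω t) atTop (𝓝 (cdf ν t)) := fun t ht =>
    tendsto_cdf_of_tendsto_averages hsep hK hcoeff.diff_α.continuousOn hcoeff.diff_β.continuousOn
      hC' hb_pos hb_lim hεω hω h1 h2 h3 h4 ht
  refine ⟨hlim, fun a c ha _ hc => tendstoUniformlyOn_of_monotoneOn (m := 0) (M := M) ?_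
    hsep.F_cont (fun t ht => hlim t ⟨ht.1.le, ht.2⟩) ha hc⟩
  filter_upwards [eventually_ge_atTop 1] with n hn using (hω n hn).1.mono
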